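/- For integers $m,n\ge 1$ and $p\in[0,1]$ let $\mathbf R\in\{0,1\}^{m\times n}$ be a random matrix with independent entries, each equal to $1$ with probability $p$. It is the representation matrix of a weighted random intersection graph $G$ on the vertex set $[n]$, in which the edge $\{i,j\}$, $i\ne j$, has weight $[\mathbf R^T\mathbf R]_{i,j}$. A 2-coloring $\mathbf x\in\{-1,+1\}^n$ defines a cut of $G$, whose weight is the sum of the weights of the edges $\{i,j\}$ with $x_i=+1$ and $x_j=-1$. A random cut is given by a uniformly random $\mathbf x$; its expected weight (over $\mathbf R$ and $\mathbf x$) is $\frac14\mathbb E\big[\sum_{i\ne j}[\mathbf R^T\mathbf R]_{i,j}\big]$. The Majority Cut algorithm with parameter $\epsilon\in(0,1)$ and a given ordering $v_1,\dots,v_n$ of the vertices (not depending on $\mathbf R$) colors the vertices one after the other: for $t\le\epsilon n$ the color $x_{v_t}$ is $+1$ or $-1$ independently with probability $\frac12$ each, and for $t>\epsilon n$ it is $-1$ if $\sum_{i<t}[\mathbf R^T\mathbf R]_{v_i,v_t}\,x_{v_i}\ge 0$ and $+1$ otherwise. **Theorem.** Let $m=n$ and $p=c/n$. There is a constant $c_0>0$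 such that for every constant $c\ge c_0$ and every $\delta>0$ there are a constant $\beta\ge\sqrt{\frac{16}{27\pi c^3}}-\delta$ and an $\epsilon_0\in(0,1)$ such that for every $\epsilon\in(0,\epsilon_0)$ and all choices of the orderings (one for each $n$), the following holds with probability tending to $1$ as $n\to\infty$ over the choice of $\mathbf R$: the Majority Cut algorithm with parameter $\epsilon$ constructs a cut whose expected weight, over the random choices of the algorithm for the given $\mathbf R$, is at least $$(1+\beta)\,\frac14\,\mathbb E\Big[\sum_{i\neq j}[\mathbf R^T\mathbf R]_{i,j}\Big],$$ that is, at least $1+\beta$ times the expected weight of a random cut. -/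

import Mathlib

open MeasureTheory ProbabilityTheory Filter Topology
open scoped BigOperators Matrix

noncomputable section

/-- The law of the label choices in the weighted random intersection graph model with `n` vertices,
`m` labels and parameter `p`: `ω (ℓ, v)` says whether vertex `v` chooses label `ℓ`, and all these
choices are independent Bernoulli variables with success probability `p`. -/
def labelLaw (m n : ℕ) (p : unitInterval) : Measure (Fin m × Fin n → Bool) :=
  Measure.pi fun _ => bernoulliMeasure true false p

/-- The representation matrix `R ∈ {0,1}^{m × n}`. -/
def repMatrix {m n : ℕ} (ω : Fin m × Fin n → Bool) : Matrix (Fin m) (Fin n) ℝ :=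
  fun ℓ v => if ω (ℓ, v) then 1 else 0

/-- The weight matrix `RᵀR` of the weighted intersection graph with representation matrix `R`. -/
def weightMatrix {m n : ℕ} (R : Matrix (Fin m) (Fin n) ℝ) : Matrix (Fin n) (Fin n) ℝ :=
  Rᵀ * R

/-- The weight of the cut given by a 2-coloring `x ∈ {-1,+1}^n`, with parts `A = {x = +1}` and
`B = {x = -1}`: the total weight of the edges `{i, j}` with `i ∈ A` and `j ∈ B`
(for a symmetric weight matrix `W`; non-edges have weight `0`). -/
def cutWeight {n : ℕ} (W : Matrix (Fin n) (Fin n) ℝ) (x : Fin n → ℤˣ) : ℝ :=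
  ∑ i, ∑ j, if x i = 1 ∧ x j = -1 then W i j else 0

/-- The colors chosen by the Majority Cut algorithm, in the order in which they are chosen: the
`t`-th vertex considered is `σ t` (with `t` counted from `0`), and it receives the color
`majoritySeq W σ ε b t`. The vertices number `1, …, εn` take the color given by their coin `b t`;
each later one looks at the sign of the weighted sum of the colors chosen so far. -/
def majoritySeq {n : ℕ} (W : Matrix (Fin n) (Fin n) ℝ) (σ : Equiv.Perm (Fin n)) (ε : ℝ)
    (b : Fin n → ℤˣ) (t : Fin n) : ℤˣ :=
  open Classical in
  if ((t : ℕ) : ℝ) + 1 ≤ ε * n then b t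
  else if 0 ≤ ∑ i : {i : Fin n // i < t},
      W (σ i.1) (σ t) * (((majoritySeq W σ ε b i.1 : ℤˣ) : ℤ) : ℝ) then -1
  else 1
termination_by t
decreasing_by exact i.2

/-- The 2-coloring of the vertices returned by the Majority Cut algorithm. -/
def majorityCut {n : ℕ} (W : Matrix (Fin n) (Fin n) ℝ) (σ : Equiv.Perm (Fin n)) (ε : ℝ)
    (b : Fin n → ℤˣ) : Fin n → ℤˣ :=
  fun v => majoritySeq W σ ε b (σ.symm v)

/-- The expected weight of the cut constructed by the Majority Cut algorithm on a fixed input, the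
expectation being over its independent fair coins `b ∈ {-1,+1}^n`. -/
def majorityExpectedWeight {n : ℕ} (W : Matrix (Fin n) (Fin n) ℝ) (σ : Equiv.Perm (Fin n))
    (ε : ℝ) : ℝ :=
  𝔼 b : Fin n → ℤˣ, cutWeight W (majorityCut W σ ε b)

/-- The expected weight of a uniformly random cut of a fixed graph. -/
def randomCutExpectedWeight {n : ℕ} (W : Matrix (Fin n) (Fin n) ℝ) : ℝ :=
  𝔼 x : Fin n → ℤˣ, cutWeight W x

/-- The success probability `c / n`, which is read as `1` for the finitely many `n < c`
(here `c > 0`). -/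
def sparseProb (c : ℝ) (n : ℕ) : unitInterval :=
  Set.projIcc (0 : ℝ) 1 zero_le_one (c / n)

end

/-! Reveal the label sets of the vertices in the order of the algorithm, with the coins `b` fixed.
After the random phase, step `t` gains over a random cut half of `|∑ ℓ, Y ℓ * η ℓ|`, where `η` is
the fresh column of bits of the current vertex and `Y ℓ` is the sum of the colors of earlier
vertices with label `ℓ`. The vector `Y` depends on the past in a complicated way, but its parities
do not: `Y ℓ` is an odd integer exactly when `ℓ` was chosen an odd number of times, and then `|Y ℓ|
≥ 1` (`abs_labelOdd_le`).

Symmetrization and the contraction principle therefore replace `Y` by the indicator of the odd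
labels, losing a factor `2`, and a quartic minorant of `|x|` bounds the first moment from below by
second and fourth moments (`le_bitExp_abs_linear`). The number of odd labels concentrates near `n *
(1 - (1 - 2 * p) ^ t) / 2`, so the symmetrized variance is about `c` for most `t`. The best tangency
point, to leading order, is `τ = √(3 * c)`; the total gain is then about `0.144 * √c * n`, while the
claim needs about `0.109 * √c * n`. The margin absorbs the random phase, the early steps and the
lower-order terms, and leaves `n / 100` (`le_majority_gain`).

Fluctuations are `O(√n)` in mean: gains minus their conditional means are orthogonal
(`bitExp_sum_sub_sq_le`), and degrees and odd counts have explicit variances. These bounds hold for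
each `b`, hence after averaging over `b`, and Markov's inequality against `n / 100` finishes. -/

/-! ### Expectations over independent Bernoulli bits as finite sums -/

section BernoulliBits

variable {ι : Type*} [Fintype ι] [DecidableEq ι]

/-- The probability of the bit vector `ω` under independent Bernoulli bits with parameter `p`. -/
noncomputable def bitWeight (p : ℝ) (ω : ι → Bool) : ℝ :=
  ∏ k, if ω k then p else 1 - p

/-- The expectation of `f` over independent Bernoulli bits with parameter `p`. -/
noncomputable def bitExp (p : ℝ) (f : (ι → Bool) → ℝ) : ℝ :=
  ∑ ω, bitWeight p ω * f ω

/-- The value `0` or `1` of a bit. -/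
noncomputable def bitVal (b : Bool) : ℝ := if b then 1 else 0

lemma bitVal_true : bitVal true = 1 := rfl

lemma bitVal_false : bitVal false = 0 := rfl

lemma bitVal_nonneg (b : Bool) : 0 ≤ bitVal b := by cases b <;> simp [bitVal]

lemma bitVal_mul_self (b : Bool) : bitVal b * bitVal b = bitVal b := by
  cases b <;> simp [bitVal]

lemma bitWeight_nonneg {ι : Type*} [Fintype ι] {p : ℝ} (h0 : 0 ≤ p) (h1 : p ≤ 1)
    (ω : ι → Bool) : 0 ≤ bitWeight p ω :=
  Finset.prod_nonneg fun k _ => by split_ifs <;> linarith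

lemma bitExp_add (p : ℝ) (f g : (ι → Bool) → ℝ) :
    bitExp p (fun ω => f ω + g ω) = bitExp p f + bitExp p g := by
  simp [bitExp, mul_add, Finset.sum_add_distrib]

lemma bitExp_sub (p : ℝ) (f g : (ι → Bool) → ℝ) :
    bitExp p (fun ω => f ω - g ω) = bitExp p f - bitExp p g := by
  simp [bitExp, mul_sub, Finset.sum_sub_distrib]

lemma bitExp_const_mul (p a : ℝ) (f : (ι → Bool) → ℝ) :
    bitExp p (fun ω => a * f ω) = a * bitExp p f := by
  simp only [bitExp, Finset.mul_sum]
  exact Finset.sum_congr rfl fun _ _ => by ring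

lemma bitExp_sum {κ : Type*} (p : ℝ) (s : Finset κ) (f : κ → (ι → Bool) → ℝ) :
    bitExp p (fun ω => ∑ k ∈ s, f k ω) = ∑ k ∈ s, bitExp p (f k) := by
  simp only [bitExp, Finset.mul_sum]
  exact Finset.sum_comm

lemma bitExp_prod_univ (p : ℝ) (g : ι → Bool → ℝ) :
    bitExp p (fun ω => ∏ k, g k (ω k)) = ∏ k, (p * g k true + (1 - p) * g k false) := by
  have h := Fintype.prod_sum (fun k b => (if b then p else 1 - p) * g k b)
  simp only [Fintype.sum_bool, if_true, Bool.false_eq_true, if_false] at h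
  rw [h]
  simp only [bitExp, bitWeight, Finset.prod_mul_distrib]

/-- Functions of distinct bits are independent. -/
lemma bitExp_prod (p : ℝ) (s : Finset ι) (g : ι → Bool → ℝ) :
    bitExp p (fun ω => ∏ k ∈ s, g k (ω k)) = ∏ k ∈ s, (p * g k true + (1 - p) * g k false) := by
  have h := bitExp_prod_univ p (fun k b => if k ∈ s then g k b else 1)
  simp only [Finset.prod_ite_mem, Finset.univ_inter] at h
  rw [h, ← Finset.univ_inter s, ← Finset.prod_ite_mem, Finset.univ_inter]
  refine Finset.prod_congr rfl fun k _ => ?_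
  split_ifs <;> ring

lemma bitExp_const (p a : ℝ) : bitExp p (fun _ : ι → Bool => a) = a := by
  have h := bitExp_prod p (∅ : Finset ι) (fun _ _ => 1)
  simp only [Finset.prod_empty] at h
  simpa [h] using bitExp_const_mul (ι := ι) p a (fun _ => 1)

lemma bitExp_mono {p : ℝ} (h0 : 0 ≤ p) (h1 : p ≤ 1) {f g : (ι → Bool) → ℝ} (h : ∀ ω, f ω ≤ g ω) :
    bitExp p f ≤ bitExp p g :=
  Finset.sum_le_sum fun ω _ => mul_le_mul_of_nonneg_left (h ω) (bitWeight_nonneg h0 h1 ω)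

lemma bitExp_nonneg {p : ℝ} (h0 : 0 ≤ p) (h1 : p ≤ 1) {f : (ι → Bool) → ℝ} (h : ∀ ω, 0 ≤ f ω) :
    0 ≤ bitExp p f :=
  Finset.sum_nonneg fun ω _ => mul_nonneg (bitWeight_nonneg h0 h1 ω) (h ω)

lemma sq_bitExp_le {p : ℝ} (h0 : 0 ≤ p) (h1 : p ≤ 1) (f : (ι → Bool) → ℝ) :
    bitExp p f ^ 2 ≤ bitExp p fun ω => f ω ^ 2 := by
  have h : 0 ≤ bitExp p fun ω => (f ω - bitExp p f) ^ 2 :=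
    bitExp_nonneg h0 h1 fun ω => sq_nonneg _
  have e : (fun ω => (f ω - bitExp p f) ^ 2) =
      fun ω => f ω ^ 2 - (2 * bitExp p f) * f ω + bitExp p f ^ 2 := by
    funext ω; ring
  rw [e, bitExp_add, bitExp_sub, bitExp_const_mul, bitExp_const] at h
  nlinarith

lemma bitExp_abs_le_sqrt {p : ℝ} (h0 : 0 ≤ p) (h1 : p ≤ 1) {f : (ι → Bool) → ℝ} {v : ℝ}
    (h : bitExp p (fun ω => f ω ^ 2) ≤ v) : bitExp p (fun ω => |f ω|) ≤ √v := by
  refine Real.le_sqrt_of_sq_le ((sq_bitExp_le h0 h1 _).trans ?_)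
  simpa only [sq_abs] using h

/-- Resampling the bits in `s` does not change the law. -/
lemma bitExp_piecewise (p : ℝ) (s : Finset ι) (f : (ι → Bool) → ℝ) :
    bitExp p (fun ω => bitExp p fun η => f (s.piecewise η ω)) = bitExp p f := by
  -- Exchanging the bits in `s` between two independent copies preserves their joint weight and is
  -- an involution.
  have key : ∀ ω η : ι → Bool, bitWeight p ω * bitWeight p η =
      bitWeight p (s.piecewise η ω) * bitWeight p (s.piecewise ω η) := by
    intro ω η
    simp only [bitWeight, ← Finset.prod_mul_distrib]
    refine Finset.prod_congr rfl fun k _ => ?_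
    by_cases hk : k ∈ s <;> simp [hk, mul_comm]
  have hinv : Function.Involutive fun x : (ι → Bool) × (ι → Bool) =>
      (s.piecewise x.2 x.1, s.piecewise x.1 x.2) := by
    rintro ⟨ω, η⟩
    ext k <;> by_cases hk : k ∈ s <;> simp [hk]
  calc bitExp p (fun ω => bitExp p fun η => f (s.piecewise η ω))
      = ∑ x : (ι → Bool) × (ι → Bool),
          bitWeight p x.1 * bitWeight p x.2 * f (s.piecewise x.2 x.1) := by
        simp only [bitExp, Finset.mul_sum, Fintype.sum_prod_type, mul_assoc]
    _ = ∑ x : (ι → Bool) × (ι → Bool), bitWeight p x.1 * bitWeight p x.2 * f x.1 := by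
        refine Fintype.sum_equiv hinv.toPerm _ _ fun x => ?_
        simp [key x.1 x.2]
    _ = bitExp p fun ω => bitExp p fun _ : ι → Bool => f ω := by
        simp only [bitExp, Finset.mul_sum, Fintype.sum_prod_type, mul_assoc]
    _ = bitExp p f := by simp only [bitExp_const]

lemma bitExp_apply (p : ℝ) (k : ι) (g : Bool → ℝ) :
    bitExp p (fun ω => g (ω k)) = p * g true + (1 - p) * g false := by
  simpa using bitExp_prod p {k} (fun _ => g)

lemma bitExp_bitVal (p : ℝ) (k : ι) : bitExp p (fun ω => bitVal (ω k)) = p := by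
  rw [bitExp_apply, bitVal_true, bitVal_false]; ring

lemma bitExp_bitVal_mul (p : ℝ) {k l : ι} (h : k ≠ l) :
    bitExp p (fun ω => bitVal (ω k) * bitVal (ω l)) = p ^ 2 := by
  have := bitExp_prod p {k, l} (fun _ => bitVal)
  simp only [Finset.prod_pair h, bitVal_true, bitVal_false] at this
  rw [this]; ring

/-- Resampling a single bit. -/
lemma bitExp_update (p : ℝ) (k : ι) (f : (ι → Bool) → ℝ) :
    bitExp p f = bitExp p fun ω =>
      p * f (Function.update ω k true) + (1 - p) * f (Function.update ω k false) := by
  rw [← bitExp_piecewise p {k} f]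
  congr 1; funext ω
  rw [← bitExp_apply p k fun b => f (Function.update ω k b)]
  congr 1; funext η
  rw [Finset.piecewise_singleton]

lemma bitExp_linear (p : ℝ) (s : Finset ι) (a : ι → ℝ) :
    bitExp p (fun ω => ∑ k ∈ s, a k * bitVal (ω k)) = p * ∑ k ∈ s, a k := by
  simp only [bitExp_sum, bitExp_const_mul, bitExp_bitVal, Finset.mul_sum]
  exact Finset.sum_congr rfl fun _ _ => mul_comm _ _

lemma bitExp_linear_sq (p : ℝ) (s : Finset ι) (a : ι → ℝ) :
    bitExp p (fun ω => (∑ k ∈ s, a k * bitVal (ω k)) ^ 2) =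
      p * (1 - p) * ∑ k ∈ s, a k ^ 2 + p ^ 2 * (∑ k ∈ s, a k) ^ 2 := by
  have h : ∀ k l : ι, bitExp p (fun ω => a k * bitVal (ω k) * (a l * bitVal (ω l))) =
      p ^ 2 * (a k * a l) + if k = l then p * (1 - p) * a k ^ 2 else 0 := by
    intro k l
    have e : (fun ω : ι → Bool => a k * bitVal (ω k) * (a l * bitVal (ω l))) =
        fun ω => (a k * a l) * (bitVal (ω k) * bitVal (ω l)) := by funext; ring
    rw [e, bitExp_const_mul]
    split_ifs with hkl
    · subst hkl
      simp only [bitVal_mul_self, bitExp_bitVal]; ring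
    · rw [bitExp_bitVal_mul p hkl]; ring
  simp only [pow_two (∑ k ∈ s, _), Finset.sum_mul_sum, bitExp_sum, h, Finset.sum_add_distrib]
  simp [Finset.mul_sum, add_comm]

lemma bitExp_linear_sub_sq (p : ℝ) (s : Finset ι) (a : ι → ℝ) :
    bitExp p (fun ω => (∑ k ∈ s, a k * bitVal (ω k) - p * ∑ k ∈ s, a k) ^ 2) =
      p * (1 - p) * ∑ k ∈ s, a k ^ 2 := by
  have e : (fun ω : ι → Bool => (∑ k ∈ s, a k * bitVal (ω k) - p * ∑ k ∈ s, a k) ^ 2) =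
      fun ω => (∑ k ∈ s, a k * bitVal (ω k)) ^ 2 -
        (2 * (p * ∑ k ∈ s, a k)) * (∑ k ∈ s, a k * bitVal (ω k)) + (p * ∑ k ∈ s, a k) ^ 2 := by
    funext; ring
  rw [e, bitExp_add, bitExp_sub, bitExp_const_mul, bitExp_const, bitExp_linear_sq, bitExp_linear]
  ring

end BernoulliBits

/-! ### The label law -/

lemma labelLaw_real_singleton (m n : ℕ) (p : unitInterval) (ω : Fin m × Fin n → Bool) :
    (labelLaw m n p).real {ω} = bitWeight (p : ℝ) ω := by
  rw [labelLaw, measureReal_def, Measure.pi_singleton, ENNReal.toReal_prod, bitWeight]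
  refine Finset.prod_congr rfl fun k _ => ?_
  rw [← measureReal_def, bernoulliMeasure_real_apply p (measurableSet_singleton _)]
  cases ω k <;> simp

lemma integral_labelLaw (m n : ℕ) (p : unitInterval) (f : (Fin m × Fin n → Bool) → ℝ) :
    ∫ ω, f ω ∂(labelLaw m n p) = bitExp (p : ℝ) f := by
  have : IsProbabilityMeasure (labelLaw m n p) := by unfold labelLaw; infer_instance
  rw [integral_fintype Integrable.of_finite]
  simp [labelLaw_real_singleton, bitExp]

/-- Markov's inequality for the deviation of `f` below its typical value. -/
lemma one_sub_le_labelLaw_real (m n : ℕ) (p : unitInterval) (f d : (Fin m × Fin n → Bool) → ℝ)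
    {a g : ℝ} (hg : 0 < g) (hd : ∀ ω, 0 ≤ d ω) (h : ∀ ω, a + g - d ω ≤ f ω) :
    1 - bitExp (p : ℝ) d / g ≤ (labelLaw m n p).real {ω | a ≤ f ω} := by
  classical
  have : IsProbabilityMeasure (labelLaw m n p) := by unfold labelLaw; infer_instance
  have e : (labelLaw m n p).real {ω | a ≤ f ω} =
      bitExp (p : ℝ) fun ω => if a ≤ f ω then 1 else 0 := by
    rw [← integral_labelLaw, ← integral_indicator_one (Set.toFinite _).measurableSet]
    refine integral_congr_ae (.of_forall fun ω => ?_)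
    simp [Set.indicator]
  have e' : 1 - bitExp (p : ℝ) d / g = bitExp (p : ℝ) fun ω => 1 - g⁻¹ * d ω := by
    rw [bitExp_sub, bitExp_const_mul, bitExp_const, div_eq_inv_mul]
  rw [e, e']
  -- The indicator of the event dominates `1 - d / g`, because `d > g` off the event.
  refine bitExp_mono p.2.1 p.2.2 fun ω => ?_
  have hω := h ω
  split_ifs with ha
  · have : 0 ≤ g⁻¹ * d ω := mul_nonneg (inv_nonneg.2 hg.le) (hd ω)
    linarith
  · have : 1 ≤ g⁻¹ * d ω := by
      rw [← div_eq_inv_mul, one_le_div hg]; linarith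
    linarith

/-! ### A lower bound for the first absolute moment of a linear form in Bernoulli bits -/

section AbsoluteMoment

variable {ι : Type*} [Fintype ι] [DecidableEq ι]

/-- The expectation of `F` over the differences of two independent vectors of Bernoulli bits. -/
noncomputable def symExp (p : ℝ) (F : (ι → ℝ) → ℝ) : ℝ :=
  bitExp p fun η : ι → Bool => bitExp p fun η' : ι → Bool =>
    F fun k => bitVal (η k) - bitVal (η' k)

lemma symExp_add (p : ℝ) (F G : (ι → ℝ) → ℝ) :
    symExp p (fun ξ => F ξ + G ξ) = symExp p F + symExp p G := by
  simp only [symExp, bitExp_add]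

lemma symExp_sub (p : ℝ) (F G : (ι → ℝ) → ℝ) :
    symExp p (fun ξ => F ξ - G ξ) = symExp p F - symExp p G := by
  simp only [symExp, bitExp_sub]

lemma symExp_const_mul (p a : ℝ) (F : (ι → ℝ) → ℝ) :
    symExp p (fun ξ => a * F ξ) = a * symExp p F := by
  simp only [symExp, bitExp_const_mul]

lemma symExp_const (p a : ℝ) : symExp p (fun _ : ι → ℝ => a) = a := by
  simp only [symExp, bitExp_const]

lemma symExp_mono {p : ℝ} (h0 : 0 ≤ p) (h1 : p ≤ 1) {F G : (ι → ℝ) → ℝ} (h : ∀ ξ, F ξ ≤ G ξ) :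
    symExp p F ≤ symExp p G :=
  bitExp_mono h0 h1 fun _ => bitExp_mono h0 h1 fun _ => h _

/-- Resampling one coordinate, which takes the values `1`, `-1` and `0`. -/
lemma symExp_update (p : ℝ) (k : ι) (F : (ι → ℝ) → ℝ) :
    symExp p F = symExp p fun ξ =>
      p * (1 - p) * (F (Function.update ξ k 1) + F (Function.update ξ k (-1))) +
        (1 - 2 * (p * (1 - p))) * F (Function.update ξ k 0) := by
  have key : ∀ (η η' : ι → Bool) (b b' : Bool),
      (fun j => bitVal (Function.update η k b j) - bitVal (Function.update η' k b' j)) =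
        Function.update (fun j => bitVal (η j) - bitVal (η' j)) k (bitVal b - bitVal b') := by
    intro η η' b b'
    funext j
    by_cases hj : j = k
    · subst hj; simp
    · simp [hj]
  unfold symExp
  rw [bitExp_update p k]
  congr 1; funext η
  rw [bitExp_update p k, bitExp_update p k (fun η' => F _), ← bitExp_const_mul, ← bitExp_const_mul,
    ← bitExp_add]
  congr 1; funext η'
  simp only [key, bitVal_true, bitVal_false, sub_self, sub_zero, zero_sub]
  ring

lemma sum_insert_update {ι : Type*} [DecidableEq ι] {k : ι} {s : Finset ι} (hk : k ∉ s)
    (ξ y : ι → ℝ) (v : ℝ) :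
    ∑ j ∈ insert k s, Function.update ξ k v j * y j = v * y k + ∑ j ∈ s, ξ j * y j := by
  rw [Finset.sum_insert hk, Function.update_self]
  congr 1
  refine Finset.sum_congr rfl fun j hj => ?_
  rw [Function.update_of_ne (ne_of_mem_of_not_mem hj hk)]

/-- Averages of a function of a linear form, computed by integrating out one coordinate. -/
lemma symExp_sum_insert (p : ℝ) {k : ι} {s : Finset ι} (hk : k ∉ s) (y : ι → ℝ) (G : ℝ → ℝ) :
    symExp p (fun ξ => G (∑ j ∈ insert k s, ξ j * y j)) = symExp p fun ξ =>
      p * (1 - p) * (G (y k + ∑ j ∈ s, ξ j * y j) + G (-y k + ∑ j ∈ s, ξ j * y j)) +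
        (1 - 2 * (p * (1 - p))) * G (∑ j ∈ s, ξ j * y j) := by
  rw [symExp_update p k]
  simp only [sum_insert_update hk, one_mul, neg_mul, zero_mul, zero_add]

/-- As a function of `z` the left side is even and convex, hence monotone in `|z|`. This is the
contraction principle for one coordinate. -/
lemma abs_add_add_abs_sub_le {a y z : ℝ} (h : |z| ≤ |y|) :
    |z + a| + |-z + a| ≤ |y + a| + |-y + a| := by
  rcases abs_cases z with hz | hz <;> rcases abs_cases y with hy | hy <;>
  rcases abs_cases (z + a) with h1 | h1 <;> rcases abs_cases (-z + a) with h2 | h2 <;>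
  rcases abs_cases (y + a) with h3 | h3 <;> rcases abs_cases (-y + a) with h4 | h4 <;> linarith

/-- The contraction principle. -/
lemma symExp_abs_contraction {p : ℝ} (h0 : 0 ≤ p) (h1 : p ≤ 1) {y z : ι → ℝ}
    (h : ∀ k, |z k| ≤ |y k|) (s : Finset ι) (a : ℝ) :
    symExp p (fun ξ => |a + ∑ j ∈ s, ξ j * z j|) ≤
      symExp p fun ξ => |a + ∑ j ∈ s, ξ j * y j| := by
  -- The shift is generalized because integrating out coordinate `k` moves it by `±y k` or `0`.
  -- First `z k` is replaced by `y k`, then the induction hypothesis treats the three shifted forms.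
  induction s using Finset.induction_on generalizing a with
  | empty => simp
  | insert k s hk ih =>
    have hp : 0 ≤ p * (1 - p) := mul_nonneg h0 (by linarith)
    have hq : 0 ≤ 1 - 2 * (p * (1 - p)) := by nlinarith [sq_nonneg (1 - 2 * p)]
    rw [symExp_sum_insert p hk z fun x => |a + x|, symExp_sum_insert p hk y fun x => |a + x|]
    calc _ ≤ symExp p fun ξ => p * (1 - p) * (|(a + y k) + ∑ j ∈ s, ξ j * z j| +
          |(a + -y k) + ∑ j ∈ s, ξ j * z j|) +
          (1 - 2 * (p * (1 - p))) * |a + ∑ j ∈ s, ξ j * z j| := by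
          refine symExp_mono h0 h1 fun ξ => ?_
          gcongr ?_ + _
          refine mul_le_mul_of_nonneg_left ?_ hp
          have := abs_add_add_abs_sub_le (a := a + ∑ j ∈ s, ξ j * z j) (h k)
          simpa only [add_left_comm, add_assoc] using this
      _ ≤ _ := by
          simp only [symExp_add, symExp_const_mul, ← add_assoc]
          have i1 := ih (a + y k)
          have i2 := ih (a + -y k)
          have i3 := ih a
          gcongr

lemma symExp_sum_sq (p : ℝ) {z : ι → ℝ} (hz : ∀ k, z k ^ 2 = z k) (s : Finset ι) :
    symExp p (fun ξ => (∑ j ∈ s, ξ j * z j) ^ 2) = 2 * (p * (1 - p)) * ∑ j ∈ s, z j := by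
  induction s using Finset.induction_on with
  | empty => simp [symExp_const]
  | insert k s hk ih =>
    rw [symExp_sum_insert p hk z fun x => x ^ 2, Finset.sum_insert hk]
    have e : ∀ S : ℝ, p * (1 - p) * ((z k + S) ^ 2 + (-z k + S) ^ 2) +
        (1 - 2 * (p * (1 - p))) * S ^ 2 = S ^ 2 + 2 * (p * (1 - p)) * z k := by
      intro S
      linear_combination (2 * (p * (1 - p))) * hz k
    simp only [e, symExp_add, symExp_const, ih]
    ring

/-- Odd moments vanish by symmetry, so adding a coordinate of variance `w` to a form of variance `V`
adds `6 * V * w + w` to the fourth moment. The bound discards the `3 * w ^ 2` in the expansion of `3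
* (V + w) ^ 2`. -/
lemma symExp_sum_pow_four_le (p : ℝ) {z : ι → ℝ}
    (hz : ∀ k, z k ^ 2 = z k) (s : Finset ι) :
    symExp p (fun ξ => (∑ j ∈ s, ξ j * z j) ^ 4) ≤
      3 * (2 * (p * (1 - p)) * ∑ j ∈ s, z j) ^ 2 + 2 * (p * (1 - p)) * ∑ j ∈ s, z j := by
  induction s using Finset.induction_on with
  | empty => simp [symExp_const]
  | insert k s hk ih =>
    rw [symExp_sum_insert p hk z fun x => x ^ 4, Finset.sum_insert hk]
    have z4 : z k ^ 4 = z k := by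
      calc z k ^ 4 = (z k ^ 2) ^ 2 := by ring
        _ = z k := by rw [hz, hz]
    have e : ∀ S : ℝ, p * (1 - p) * ((z k + S) ^ 4 + (-z k + S) ^ 4) +
        (1 - 2 * (p * (1 - p))) * S ^ 4 =
          S ^ 4 + 12 * (p * (1 - p)) * z k * S ^ 2 + 2 * (p * (1 - p)) * z k := by
      intro S
      linear_combination (12 * (p * (1 - p)) * S ^ 2) * hz k + (2 * (p * (1 - p))) * z4
    simp only [e, symExp_add, symExp_const_mul, symExp_const, symExp_sum_sq p hz]
    have : 0 ≤ (p * (1 - p) * z k) ^ 2 := sq_nonneg _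
    nlinarith

/-- With `u = |x|`, the difference of the two sides is a positive multiple of `u * (u - τ) ^ 2 * (u
+ 2 * τ)`: the even quartic touches `|x|` at `0` and `±τ`. -/
lemma cubic_le_abs {τ : ℝ} (hτ : 0 < τ) (x : ℝ) :
    (3 * τ ^ 2 * x ^ 2 - x ^ 4) / (2 * τ ^ 3) ≤ |x| := by
  rw [div_le_iff₀ (by positivity), ← sq_abs x, show x ^ 4 = |x| ^ 4 by
    rw [pow_abs, abs_of_nonneg (by positivity)]]
  have hx := abs_nonneg x
  generalize |x| = u at *
  have : 0 ≤ u * ((u - τ) ^ 2 * (u + 2 * τ)) := by positivity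
  linarith [show u * ((u - τ) ^ 2 * (u + 2 * τ)) =
    u * (2 * τ ^ 3) - (3 * τ ^ 2 * u ^ 2 - u ^ 4) by ring]

/-- If at least `∑ z` of the coefficients of a linear form in Bernoulli bits have absolute value at
least `1`, then its first absolute moment is of the order of the square root of `p * ∑ z`. -/
lemma le_bitExp_abs_linear {p τ : ℝ} (h0 : 0 ≤ p) (h1 : p ≤ 1) (hτ : 0 < τ) {y z : ι → ℝ}
    (hz : ∀ k, z k ^ 2 = z k) (h : ∀ k, |z k| ≤ |y k|) (s : Finset ι) {v : ℝ}
    (hv : v = 2 * (p * (1 - p)) * ∑ k ∈ s, z k) :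
    (3 * τ ^ 2 * v - 3 * v ^ 2 - v) / (4 * τ ^ 3) ≤
      bitExp p fun η => |∑ k ∈ s, y k * bitVal (η k)| := by
  -- Symmetrization: `E|X - X'| ≤ 2 * E|X|` for an independent copy `X'`.
  have sym : symExp p (fun ξ => |∑ k ∈ s, ξ k * y k|) ≤
      2 * bitExp p fun η => |∑ k ∈ s, y k * bitVal (η k)| := by
    calc _ ≤ bitExp p fun η : ι → Bool => bitExp p fun η' : ι → Bool =>
          |∑ k ∈ s, y k * bitVal (η k)| + |∑ k ∈ s, y k * bitVal (η' k)| := by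
          refine bitExp_mono h0 h1 fun η => bitExp_mono h0 h1 fun η' => ?_
          refine le_of_eq_of_le ?_ (abs_sub _ _)
          rw [← Finset.sum_sub_distrib]
          exact congrArg abs (Finset.sum_congr rfl fun k _ => by ring)
      _ = _ := by
          simp only [bitExp_add, bitExp_const]; ring
  have con := symExp_abs_contraction h0 h1 h s 0
  simp only [zero_add] at con
  have low : symExp p (fun ξ => (2 * τ ^ 3)⁻¹ * (3 * τ ^ 2 * (∑ k ∈ s, ξ k * z k) ^ 2 -
      (∑ k ∈ s, ξ k * z k) ^ 4)) ≤ symExp p fun ξ => |∑ k ∈ s, ξ k * z k| :=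
    symExp_mono h0 h1 fun ξ => by
      rw [← div_eq_inv_mul]; exact cubic_le_abs hτ _
  rw [symExp_const_mul, symExp_sub, symExp_const_mul, symExp_sum_sq p hz, ← hv] at low
  have four := symExp_sum_pow_four_le p hz s
  rw [← hv] at four
  have : (2 * τ ^ 3)⁻¹ * (3 * τ ^ 2 * v - (3 * v ^ 2 + v)) ≤
      2 * bitExp p fun η => |∑ k ∈ s, y k * bitVal (η k)| := by
    refine le_trans ?_ (low.trans (con.trans sym))
    gcongr
  calc _ = (2 * τ ^ 3)⁻¹ * (3 * τ ^ 2 * v - (3 * v ^ 2 + v)) / 2 := by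
        field_simp; ring
    _ ≤ _ := by linarith

end AbsoluteMoment

/-! ### Cut weights -/

/-- The real number `±1` given by a color. -/
def signVal (x : ℤˣ) : ℝ := ((x : ℤ) : ℝ)

lemma signVal_neg (x : ℤˣ) : signVal (-x) = -signVal x := by simp [signVal]

lemma signVal_mul_self (x : ℤˣ) : signVal x * signVal x = 1 := by
  rcases Int.units_eq_one_or x with rfl | rfl <;> simp [signVal]

/-- The indicator is `(1 + x) * (1 - y) / 4`, expanded so that each monomial can be averaged or
cancelled separately. -/
lemma ite_cut_eq (x y : ℤˣ) (w : ℝ) : (if x = 1 ∧ y = -1 then w else 0) =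
    1 / 4 * (w + w * signVal x - w * signVal y - w * (signVal x * signVal y)) := by
  rcases Int.units_eq_one_or x with rfl | rfl <;> rcases Int.units_eq_one_or y with rfl | rfl <;>
    (simp [signVal]; try ring)

/-- An average over colorings vanishes if changing one color changes the sign of the summand. -/
lemma expect_eq_zero_of_flip {n : ℕ} (t : Fin n) (f : (Fin n → ℤˣ) → ℝ)
    (h : ∀ b, f (Function.update b t (-b t)) = -f b) : 𝔼 b : Fin n → ℤˣ, f b = 0 := by
  have hinv : Function.Involutive fun b : Fin n → ℤˣ => Function.update b t (-b t) := by
    intro b; simp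
  have e : 𝔼 b : Fin n → ℤˣ, f b = 𝔼 b : Fin n → ℤˣ, -f b := by
    refine Fintype.expect_equiv hinv.toPerm _ _ fun b => ?_
    simp [h]
  rw [Finset.expect_neg_distrib] at e
  linarith

lemma expect_cut_pair {n : ℕ} (i j : Fin n) (w : ℝ) :
    𝔼 x : Fin n → ℤˣ, (if x i = 1 ∧ x j = -1 then w else 0) =
      1 / 4 * if i ≠ j then w else 0 := by
  simp only [ite_cut_eq, ← Finset.mul_expect, Finset.expect_sub_distrib,
    Finset.expect_add_distrib, Fintype.expect_const]
  rw [expect_eq_zero_of_flip i (fun b => signVal (b i)) (by simp [signVal_neg]),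
    expect_eq_zero_of_flip j (fun b => signVal (b j)) (by simp [signVal_neg])]
  split_ifs with h
  · rw [expect_eq_zero_of_flip i (fun b => signVal (b i) * signVal (b j))
      (by simp [signVal_neg, Function.update_of_ne (Ne.symm h)])]
    ring
  · rw [not_not] at h
    subst h
    simp [signVal_mul_self]

lemma randomCutExpectedWeight_eq {n : ℕ} (W : Matrix (Fin n) (Fin n) ℝ) :
    randomCutExpectedWeight W = 1 / 4 * ∑ i, ∑ j, if i ≠ j then W i j else 0 := by
  unfold randomCutExpectedWeight cutWeight
  simp only [Finset.expect_sum_comm, expect_cut_pair, Finset.mul_sum]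

lemma sum_sum_eq_two_mul_sum_Iio {n : ℕ} (G : Fin n → Fin n → ℝ) (hs : ∀ s t, G s t = G t s)
    (hd : ∀ t, G t t = 0) : ∑ s, ∑ t, G s t = 2 * ∑ t, ∑ s ∈ Finset.Iio t, G s t := by
  have h1 : ∀ s t, G s t = (if s < t then G s t else 0) + (if t < s then G s t else 0) := by
    intro s t
    rcases lt_trichotomy s t with h | h | h
    · simp [h, h.not_gt]
    · simp [h, hd]
    · simp [h, h.not_gt]
  have h2 : ∑ t, ∑ s ∈ Finset.Iio t, G s t = ∑ t, ∑ s, if s < t then G s t else 0 := by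
    refine Finset.sum_congr rfl fun t _ => ?_
    rw [← Finset.sum_filter]
    congr 1; ext s; simp
  calc ∑ s, ∑ t, G s t
      = ∑ s, ∑ t, ((if s < t then G s t else 0) + (if t < s then G s t else 0)) :=
        Finset.sum_congr rfl fun s _ => Finset.sum_congr rfl fun t _ => h1 s t
    _ = (∑ t, ∑ s, if s < t then G s t else 0) + ∑ t, ∑ s, if s < t then G s t else 0 := by
        simp only [Finset.sum_add_distrib]
        congr 1
        · exact Finset.sum_comm
        · simp only [fun s t => hs t s]
    _ = _ := by rw [h2]; ring

/-- The terms linear in the colors cancel by symmetry of `W`, and the diagonal drops out because `1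
- x i ^ 2 = 0`. Each remaining pair is charged to its later vertex. -/
lemma cutWeight_eq {n : ℕ} {W : Matrix (Fin n) (Fin n) ℝ} (hW : ∀ i j, W i j = W j i)
    (σ : Equiv.Perm (Fin n)) (x : Fin n → ℤˣ) :
    cutWeight W x = 1 / 2 * ∑ t, ((∑ i ∈ Finset.Iio t, W (σ i) (σ t)) -
      signVal (x (σ t)) * ∑ i ∈ Finset.Iio t, W (σ i) (σ t) * signVal (x (σ i))) := by
  have h1 : cutWeight W x = 1 / 4 * ∑ i, ∑ j, W i j * (1 - signVal (x i) * signVal (x j)) := by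
    unfold cutWeight
    have e : ∀ i j, (if x i = 1 ∧ x j = -1 then W i j else 0) =
        1 / 4 * (W i j * (1 - signVal (x i) * signVal (x j))) +
          (1 / 4 * (W i j * signVal (x i)) - 1 / 4 * (W i j * signVal (x j))) := by
      intro i j; rw [ite_cut_eq]; ring
    have e2 : ∑ i, ∑ j, 1 / 4 * (W i j * signVal (x j)) =
        ∑ i, ∑ j, 1 / 4 * (W i j * signVal (x i)) := by
      rw [Finset.sum_comm]
      exact Finset.sum_congr rfl fun i _ => Finset.sum_congr rfl fun j _ => by rw [hW]
    simp only [e, Finset.sum_add_distrib, Finset.sum_sub_distrib, e2, sub_self, add_zero,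
      Finset.mul_sum]
  have h2 : ∑ i, ∑ j, W i j * (1 - signVal (x i) * signVal (x j)) =
      ∑ s, ∑ t, W (σ s) (σ t) * (1 - signVal (x (σ s)) * signVal (x (σ t))) :=
    (Equiv.sum_comp σ fun i => ∑ j, W i j * (1 - signVal (x i) * signVal (x j))).symm.trans
      (Finset.sum_congr rfl fun s _ => (Equiv.sum_comp σ fun j =>
        W (σ s) j * (1 - signVal (x (σ s)) * signVal (x j))).symm)
  rw [h1, h2, sum_sum_eq_two_mul_sum_Iio _ (fun s t => by rw [hW]; ring)
    (fun t => by rw [signVal_mul_self]; ring), ← mul_assoc,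
    show (1 / 4 * 2 : ℝ) = 1 / 2 by norm_num]
  congr 1
  refine Finset.sum_congr rfl fun t _ => ?_
  rw [Finset.mul_sum, ← Finset.sum_sub_distrib]
  exact Finset.sum_congr rfl fun s _ => by ring

/-! ### The Majority Cut algorithm -/

section Majority

variable {n : ℕ}

/-- The weighted sum of the previously chosen colors, seen from the `t`-th vertex. -/
noncomputable def majoritySum (W : Matrix (Fin n) (Fin n) ℝ) (σ : Equiv.Perm (Fin n)) (ε : ℝ)
    (b : Fin n → ℤˣ) (t : Fin n) : ℝ :=
  ∑ i ∈ Finset.Iio t, W (σ i) (σ t) * signVal (majoritySeq W σ ε b i)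

lemma majoritySeq_eq (W : Matrix (Fin n) (Fin n) ℝ) (σ : Equiv.Perm (Fin n)) (ε : ℝ)
    (b : Fin n → ℤˣ) (t : Fin n) : majoritySeq W σ ε b t =
      if ((t : ℕ) : ℝ) + 1 ≤ ε * n then b t else if 0 ≤ majoritySum W σ ε b t then -1 else 1 := by
  have h : majoritySum W σ ε b t = ∑ i : {i : Fin n // i < t},
      W (σ i.1) (σ t) * (((majoritySeq W σ ε b i.1 : ℤˣ) : ℤ) : ℝ) :=
    Finset.sum_subtype _ (by simp) _
  rw [majoritySeq, h]

/-- The first colors only depend on the first coins and on the weights between the first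
vertices. -/
lemma majoritySeq_congr {W W' : Matrix (Fin n) (Fin n) ℝ} {σ : Equiv.Perm (Fin n)} {ε : ℝ}
    {b b' : Fin n → ℤˣ} {u : Fin n} (hW : ∀ i j, i < u → j < u → W (σ i) (σ j) = W' (σ i) (σ j))
    (hb : ∀ i < u, b i = b' i) (t : Fin n) (ht : t < u) :
    majoritySeq W σ ε b t = majoritySeq W' σ ε b' t := by
  induction t using WellFoundedLT.induction with
  | _ t ih =>
    have h : majoritySum W σ ε b t = majoritySum W' σ ε b' t := by
      refine Finset.sum_congr rfl fun i hi => ?_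
      have hi := Finset.mem_Iio.1 hi
      rw [hW i t (hi.trans ht) ht, ih i hi (hi.trans ht)]
    rw [majoritySeq_eq, majoritySeq_eq, h, hb t ht]

/-- The majority rule picks the color opposite to the sign of the sum; at a tie both sides are `0`.
-/
lemma neg_signVal_mul_majoritySum (W : Matrix (Fin n) (Fin n) ℝ) (σ : Equiv.Perm (Fin n)) (ε : ℝ)
    (b : Fin n → ℤˣ) (t : Fin n) (ht : ¬ ((t : ℕ) : ℝ) + 1 ≤ ε * n) :
    -(signVal (majoritySeq W σ ε b t) * majoritySum W σ ε b t) = |majoritySum W σ ε b t| := by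
  rw [majoritySeq_eq, if_neg ht]
  split_ifs with h
  · rw [abs_of_nonneg h]; simp [signVal]
  · rw [abs_of_neg (not_le.1 h)]; simp [signVal]

/-- The coin of step `t` is independent of all earlier colors, so flipping it only changes the sign
of the product. -/
lemma expect_signVal_mul_majoritySum (W : Matrix (Fin n) (Fin n) ℝ) (σ : Equiv.Perm (Fin n))
    (ε : ℝ) (t : Fin n) (ht : ((t : ℕ) : ℝ) + 1 ≤ ε * n) :
    𝔼 b : Fin n → ℤˣ, signVal (majoritySeq W σ ε b t) * majoritySum W σ ε b t = 0 := by
  refine expect_eq_zero_of_flip t _ fun b => ?_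
  have h : majoritySum W σ ε (Function.update b t (-b t)) t = majoritySum W σ ε b t := by
    refine Finset.sum_congr rfl fun i hi => ?_
    rw [majoritySeq_congr (u := t) (fun _ _ _ _ => rfl) (fun j hj => ?_) i (Finset.mem_Iio.1 hi)]
    rw [Function.update_of_ne hj.ne]
  rw [h, majoritySeq_eq, majoritySeq_eq, if_pos ht, if_pos ht, Function.update_self, signVal_neg]
  ring

open Classical in
/-- The weight gained at step `t`, up to a term of mean zero: the weight of the edges to the
vertices colored before, plus the bias exploited by the algorithm after the random phase. -/
noncomputable def stepGain (W : Matrix (Fin n) (Fin n) ℝ) (σ : Equiv.Perm (Fin n)) (ε : ℝ)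
    (b : Fin n → ℤˣ) (t : Fin n) : ℝ :=
  (∑ i ∈ Finset.Iio t, W (σ i) (σ t)) +
    if ((t : ℕ) : ℝ) + 1 ≤ ε * n then 0 else |majoritySum W σ ε b t|

lemma majorityExpectedWeight_eq {W : Matrix (Fin n) (Fin n) ℝ} (hW : ∀ i j, W i j = W j i)
    (σ : Equiv.Perm (Fin n)) (ε : ℝ) :
    majorityExpectedWeight W σ ε = 1 / 2 * 𝔼 b : Fin n → ℤˣ, ∑ t, stepGain W σ ε b t := by
  unfold majorityExpectedWeight
  have e : ∀ b, cutWeight W (majorityCut W σ ε b) = 1 / 2 * ∑ t,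
      ((∑ i ∈ Finset.Iio t, W (σ i) (σ t)) -
        signVal (majoritySeq W σ ε b t) * majoritySum W σ ε b t) := by
    intro b
    rw [cutWeight_eq hW σ]
    simp only [majorityCut, Equiv.symm_apply_apply, majoritySum]
  simp only [e, ← Finset.mul_expect, Finset.expect_sum_comm]
  congr 1
  refine Finset.sum_congr rfl fun t _ => ?_
  by_cases ht : ((t : ℕ) : ℝ) + 1 ≤ ε * n
  · rw [Finset.expect_sub_distrib, expect_signVal_mul_majoritySum W σ ε t ht]
    simp [stepGain, ht]
  · refine Finset.expect_congr rfl fun b _ => ?_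
    rw [stepGain, if_neg ht, ← neg_signVal_mul_majoritySum W σ ε b t ht]
    ring

end Majority

/-! ### Sums of martingale differences -/

section MartingaleDifferences

variable {ι : Type*} [Fintype ι] [DecidableEq ι] {n : ℕ}

/-- If `X t` does not depend on the blocks `s u` of bits with `u > t`, then the sum of the
differences between `X t` and its average over the block `s t` has small variance. -/
lemma bitExp_sum_sub_sq_le {p : ℝ} (h0 : 0 ≤ p) (h1 : p ≤ 1) (s : Fin n → Finset ι)
    (hs : ∀ t u, t < u → Disjoint (s t) (s u)) (X : Fin n → (ι → Bool) → ℝ)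
    (hX : ∀ t u, t < u → ∀ ω η, X t ((s u).piecewise η ω) = X t ω) :
    bitExp p (fun ω => (∑ t, (X t ω - bitExp p fun η => X t ((s t).piecewise η ω))) ^ 2) ≤
      ∑ t, bitExp p fun ω => X t ω ^ 2 := by
  set C : Fin n → (ι → Bool) → ℝ := fun t ω => bitExp p fun η => X t ((s t).piecewise η ω)
    with hC
  have C_self : ∀ t ω ζ, C t ((s t).piecewise ζ ω) = C t ω := by
    intro t ω ζ
    simp only [hC]
    congr 1; funext η
    congr 1; funext k
    by_cases hk : k ∈ s t <;> simp [hk]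
  have C_lt : ∀ t u, t < u → ∀ ω ζ, C t ((s u).piecewise ζ ω) = C t ω := by
    intro t u htu ω ζ
    simp only [hC]
    congr 1; funext η
    rw [← hX t u htu ((s t).piecewise η ω) ζ]
    congr 1; funext k
    by_cases hk : k ∈ s t
    · simp [hk, Finset.disjoint_left.1 (hs t u htu) hk]
    · by_cases hk' : k ∈ s u <;> simp [hk, hk']
  -- Averaging over block `u` leaves the earlier factor fixed and annihilates `X u - C u`.
  have cross : ∀ t u, t < u →
      bitExp p (fun ω => (X t ω - C t ω) * (X u ω - C u ω)) = 0 := by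
    intro t u htu
    rw [← bitExp_piecewise p (s u)]
    simp only [hX t u htu, C_lt t u htu, C_self, bitExp_const_mul, bitExp_sub, bitExp_const]
    change bitExp p (fun ω => (X t ω - C t ω) * (C u ω - C u ω)) = 0
    simp only [sub_self, mul_zero, bitExp_const]
  -- A conditional variance is at most the conditional second moment.
  have diag : ∀ t, bitExp p (fun ω => (X t ω - C t ω) * (X t ω - C t ω)) ≤
      bitExp p fun ω => X t ω ^ 2 := by
    intro t
    rw [← bitExp_piecewise p (s t) fun ω => X t ω ^ 2, ← bitExp_piecewise p (s t)]
    refine bitExp_mono h0 h1 fun ω => ?_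
    have e : ∀ η, (X t ((s t).piecewise η ω) - C t ω) * (X t ((s t).piecewise η ω) - C t ω) =
        X t ((s t).piecewise η ω) ^ 2 - 2 * C t ω * X t ((s t).piecewise η ω) + C t ω ^ 2 := by
      intro η; ring
    simp only [C_self, e, bitExp_add, bitExp_sub, bitExp_const_mul, bitExp_const]
    change _ - 2 * C t ω * C t ω + _ ≤ _
    nlinarith [sq_nonneg (C t ω)]
  simp only [pow_two (∑ t, _), Finset.sum_mul_sum, bitExp_sum]
  refine Finset.sum_le_sum fun t _ => ?_
  rw [Finset.sum_eq_single t]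
  · exact diag t
  · intro u _ hu
    rcases lt_or_gt_of_ne hu with h | h
    · refine Eq.trans ?_ (cross u t h)
      congr 1; funext ω
      exact mul_comm _ _
    · exact cross t u h
  · simp

end MartingaleDifferences

/-! ### Labels seen before a vertex is colored -/

section Labels

variable {m n : ℕ}

lemma weightMatrix_repMatrix (ω : Fin m × Fin n → Bool) (i j : Fin n) :
    weightMatrix (repMatrix ω) i j = ∑ ℓ, bitVal (ω (ℓ, i)) * bitVal (ω (ℓ, j)) := rfl

lemma weightMatrix_repMatrix_comm (ω : Fin m × Fin n → Bool) (i j : Fin n) :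
    weightMatrix (repMatrix ω) i j = weightMatrix (repMatrix ω) j i := by
  simp only [weightMatrix_repMatrix, mul_comm]

/-- The bits that describe the labels of the vertex `v`. -/
def columnBits (m : ℕ) {n : ℕ} (v : Fin n) : Finset (Fin m × Fin n) := Finset.univ ×ˢ {v}

lemma mem_columnBits (v : Fin n) (k : Fin m × Fin n) : k ∈ columnBits m v ↔ k.2 = v := by
  rw [columnBits, Finset.mem_product]
  simp

lemma sum_columnBits (v : Fin n) (f : Fin m × Fin n → ℝ) :
    ∑ k ∈ columnBits m v, f k = ∑ ℓ, f (ℓ, v) := by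
  simp [columnBits]

lemma piecewise_columnBits_self (ω η : Fin m × Fin n → Bool) (v : Fin n) (ℓ : Fin m) :
    (columnBits m v).piecewise η ω (ℓ, v) = η (ℓ, v) := by
  simp [mem_columnBits]

lemma piecewise_columnBits_of_ne (ω η : Fin m × Fin n → Bool) {v w : Fin n} (h : w ≠ v)
    (ℓ : Fin m) : (columnBits m v).piecewise η ω (ℓ, w) = ω (ℓ, w) := by
  simp [mem_columnBits, h]

/-- The number of vertices before time `t` that have the label `ℓ`. -/
noncomputable def labelDeg (σ : Equiv.Perm (Fin n)) (ω : Fin m × Fin n → Bool) (t : Fin n)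
    (ℓ : Fin m) : ℝ :=
  ∑ i ∈ Finset.Iio t, bitVal (ω (ℓ, σ i))

/-- The sum of the colors of the vertices before time `t` that have the label `ℓ`. -/
noncomputable def labelBias (σ : Equiv.Perm (Fin n)) (ε : ℝ) (b : Fin n → ℤˣ)
    (ω : Fin m × Fin n → Bool) (t : Fin n) (ℓ : Fin m) : ℝ :=
  ∑ i ∈ Finset.Iio t, signVal (majoritySeq (weightMatrix (repMatrix ω)) σ ε b i) *
    bitVal (ω (ℓ, σ i))

/-- The sign `(-1) ^ d`, where `d` is the number of vertices before time `t` with label `ℓ`. -/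
noncomputable def labelParity (σ : Equiv.Perm (Fin n)) (ω : Fin m × Fin n → Bool) (t : Fin n)
    (ℓ : Fin m) : ℝ :=
  ∏ i ∈ Finset.Iio t, (1 - 2 * bitVal (ω (ℓ, σ i)))

/-- The indicator of the event that the label `ℓ` was chosen an odd number of times before `t`. -/
noncomputable def labelOdd (σ : Equiv.Perm (Fin n)) (ω : Fin m × Fin n → Bool) (t : Fin n)
    (ℓ : Fin m) : ℝ :=
  (1 - labelParity σ ω t ℓ) / 2

lemma sum_weight_eq (σ : Equiv.Perm (Fin n)) (ω : Fin m × Fin n → Bool) (t : Fin n) :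
    ∑ i ∈ Finset.Iio t, weightMatrix (repMatrix ω) (σ i) (σ t) =
      ∑ ℓ, labelDeg σ ω t ℓ * bitVal (ω (ℓ, σ t)) := by
  simp only [weightMatrix_repMatrix, labelDeg, Finset.sum_mul]
  exact Finset.sum_comm

/-- Grouping by labels exhibits the sum as a linear form in the fresh bits of `σ t`, with
coefficients determined by the past. -/
lemma majoritySum_eq (σ : Equiv.Perm (Fin n)) (ε : ℝ) (b : Fin n → ℤˣ)
    (ω : Fin m × Fin n → Bool) (t : Fin n) :
    majoritySum (weightMatrix (repMatrix ω)) σ ε b t =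
      ∑ ℓ, labelBias σ ε b ω t ℓ * bitVal (ω (ℓ, σ t)) := by
  simp only [majoritySum, weightMatrix_repMatrix, labelBias, Finset.sum_mul]
  rw [Finset.sum_comm]
  exact Finset.sum_congr rfl fun _ _ => Finset.sum_congr rfl fun _ _ => by ring

lemma labelDeg_congr {σ : Equiv.Perm (Fin n)} {ω ω' : Fin m × Fin n → Bool} {t : Fin n}
    (h : ∀ i < t, ∀ ℓ, ω (ℓ, σ i) = ω' (ℓ, σ i)) (ℓ : Fin m) :
    labelDeg σ ω t ℓ = labelDeg σ ω' t ℓ :=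
  Finset.sum_congr rfl fun i hi => by rw [h i (Finset.mem_Iio.1 hi)]

/-- Colors before `t` use only weights among earlier vertices, so these coefficients stay fixed when
the column of `σ t` is resampled. -/
lemma labelBias_congr {σ : Equiv.Perm (Fin n)} {ε : ℝ} {b : Fin n → ℤˣ}
    {ω ω' : Fin m × Fin n → Bool} {t : Fin n}
    (h : ∀ i < t, ∀ ℓ, ω (ℓ, σ i) = ω' (ℓ, σ i)) (ℓ : Fin m) :
    labelBias σ ε b ω t ℓ = labelBias σ ε b ω' t ℓ := by
  refine Finset.sum_congr rfl fun i hi => ?_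
  have hi := Finset.mem_Iio.1 hi
  rw [h i hi, majoritySeq_congr (u := t) (fun j k hj hk => ?_) (fun _ _ => rfl) i hi]
  simp only [weightMatrix_repMatrix, h j hj, h k hk]

/-- The gain at step `t` as a function of the labels of the `t`-th vertex. -/
lemma stepGain_eq (σ : Equiv.Perm (Fin n)) (ε : ℝ) (b : Fin n → ℤˣ)
    (ω : Fin m × Fin n → Bool) (t : Fin n) :
    stepGain (weightMatrix (repMatrix ω)) σ ε b t =
      (∑ ℓ, labelDeg σ ω t ℓ * bitVal (ω (ℓ, σ t))) +
        if ((t : ℕ) : ℝ) + 1 ≤ ε * n then 0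
        else |∑ ℓ, labelBias σ ε b ω t ℓ * bitVal (ω (ℓ, σ t))| := by
  rw [stepGain, sum_weight_eq, majoritySum_eq]

lemma stepGain_piecewise_of_lt (σ : Equiv.Perm (Fin n)) (ε : ℝ) (b : Fin n → ℤˣ) {t u : Fin n}
    (h : t < u) (ω η : Fin m × Fin n → Bool) :
    stepGain (weightMatrix (repMatrix ((columnBits m (σ u)).piecewise η ω))) σ ε b t =
      stepGain (weightMatrix (repMatrix ω)) σ ε b t := by
  have e : ∀ i ≤ t, ∀ ℓ, (columnBits m (σ u)).piecewise η ω (ℓ, σ i) = ω (ℓ, σ i) :=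
    fun i hi ℓ => piecewise_columnBits_of_ne ω η (σ.injective.ne (hi.trans_lt h).ne) ℓ
  simp only [stepGain_eq, labelDeg_congr fun i hi => e i (le_of_lt hi),
    labelBias_congr fun i hi => e i (le_of_lt hi), e t le_rfl]

lemma stepGain_piecewise_self (σ : Equiv.Perm (Fin n)) (ε : ℝ) (b : Fin n → ℤˣ) (t : Fin n)
    (ω η : Fin m × Fin n → Bool) :
    stepGain (weightMatrix (repMatrix ((columnBits m (σ t)).piecewise η ω))) σ ε b t =
      (∑ k ∈ columnBits m (σ t), labelDeg σ ω t k.1 * bitVal (η k)) +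
        if ((t : ℕ) : ℝ) + 1 ≤ ε * n then 0
        else |∑ k ∈ columnBits m (σ t), labelBias σ ε b ω t k.1 * bitVal (η k)| := by
  have e : ∀ i < t, ∀ ℓ, (columnBits m (σ t)).piecewise η ω (ℓ, σ i) = ω (ℓ, σ i) :=
    fun i hi ℓ => piecewise_columnBits_of_ne ω η (σ.injective.ne hi.ne) ℓ
  simp only [stepGain_eq, labelDeg_congr e, labelBias_congr e, piecewise_columnBits_self,
    sum_columnBits]

/-! ### Parities -/

/-- Every selected summand is `±1`, hence odd, so the parity of the sum is that of the number
selected, whatever the signs. -/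
lemma exists_int_sum_eq_and_parity {κ : Type*} (s : Finset κ) (x : κ → ℤˣ) (r : κ → Bool) :
    ∃ Y : ℤ, ∑ i ∈ s, signVal (x i) * bitVal (r i) = Y ∧
      ((Even Y ∧ ∏ i ∈ s, (1 - 2 * bitVal (r i)) = 1) ∨
        (Odd Y ∧ ∏ i ∈ s, (1 - 2 * bitVal (r i)) = -1)) := by
  classical
  induction s using Finset.induction_on with
  | empty => exact ⟨0, by simp⟩
  | insert a s ha ih =>
    obtain ⟨Y, hY, h⟩ := ih
    rw [Finset.sum_insert ha, Finset.prod_insert ha, hY]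
    cases r a
    · refine ⟨Y, by simp [bitVal_false], ?_⟩
      simpa [bitVal_false] using h
    · refine ⟨(x a : ℤ) + Y, by simp [bitVal_true, signVal], ?_⟩
      have hx : Odd ((x a : ℤˣ) : ℤ) := by
        rcases Int.units_eq_one_or (x a) with e | e <;> simp [e]
      rcases h with ⟨he, h⟩ | ⟨ho, h⟩
      · exact Or.inr ⟨hx.add_even he, by rw [h, bitVal_true]; norm_num⟩
      · exact Or.inl ⟨hx.add_odd ho, by rw [h, bitVal_true]; norm_num⟩

lemma labelParity_sq (σ : Equiv.Perm (Fin n)) (ω : Fin m × Fin n → Bool) (t : Fin n) (ℓ : Fin m) :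
    labelParity σ ω t ℓ ^ 2 = 1 := by
  obtain ⟨-, -, ⟨-, h⟩ | ⟨-, h⟩⟩ :=
    exists_int_sum_eq_and_parity (Finset.Iio t) (fun _ => 1) (fun i => ω (ℓ, σ i)) <;>
    simp [labelParity, h]

lemma labelOdd_sq (σ : Equiv.Perm (Fin n)) (ω : Fin m × Fin n → Bool) (t : Fin n) (ℓ : Fin m) :
    labelOdd σ ω t ℓ ^ 2 = labelOdd σ ω t ℓ := by
  have := labelParity_sq σ ω t ℓ
  unfold labelOdd
  linear_combination this / 4

lemma labelOdd_nonneg (σ : Equiv.Perm (Fin n)) (ω : Fin m × Fin n → Bool) (t : Fin n)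
    (ℓ : Fin m) : 0 ≤ labelOdd σ ω t ℓ := by
  rw [← labelOdd_sq]; positivity

lemma labelOdd_le_one (σ : Equiv.Perm (Fin n)) (ω : Fin m × Fin n → Bool) (t : Fin n)
    (ℓ : Fin m) : labelOdd σ ω t ℓ ≤ 1 := by
  nlinarith [labelOdd_sq σ ω t ℓ, sq_nonneg (labelOdd σ ω t ℓ - 1)]

/-- An odd integer has absolute value at least `1`. This removes the dependence on the choices of
the algorithm. -/
lemma abs_labelOdd_le (σ : Equiv.Perm (Fin n)) (ε : ℝ) (b : Fin n → ℤˣ)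
    (ω : Fin m × Fin n → Bool) (t : Fin n) (ℓ : Fin m) :
    |labelOdd σ ω t ℓ| ≤ |labelBias σ ε b ω t ℓ| := by
  obtain ⟨Y, hY, ⟨-, h⟩ | ⟨ho, h⟩⟩ := exists_int_sum_eq_and_parity (Finset.Iio t)
    (majoritySeq (weightMatrix (repMatrix ω)) σ ε b) (fun i => ω (ℓ, σ i))
  · simp [labelOdd, labelParity, h]
  · rw [labelBias, hY, labelOdd, labelParity, h, ← Int.cast_abs]
    have : 1 ≤ |Y| := Int.one_le_abs fun e => by simp [e] at ho
    have : (1 : ℝ) ≤ ((|Y| : ℤ) : ℝ) := by exact_mod_cast this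
    norm_num
    simpa using this

/-- The number of labels that were chosen an odd number of times before `t`. -/
noncomputable def oddCount (σ : Equiv.Perm (Fin n)) (ω : Fin m × Fin n → Bool) (t : Fin n) : ℝ :=
  ∑ ℓ, labelOdd σ ω t ℓ

lemma oddCount_nonneg (σ : Equiv.Perm (Fin n)) (ω : Fin m × Fin n → Bool) (t : Fin n) :
    0 ≤ oddCount σ ω t :=
  Finset.sum_nonneg fun ℓ _ => labelOdd_nonneg σ ω t ℓ

lemma oddCount_le (σ : Equiv.Perm (Fin n)) (ω : Fin m × Fin n → Bool) (t : Fin n) :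
    oddCount σ ω t ≤ m := by
  have := Finset.sum_le_card_nsmul Finset.univ (labelOdd σ ω t) 1
    fun ℓ _ => labelOdd_le_one σ ω t ℓ
  simpa [oddCount] using this

/-- A lower bound for the expected gain at step `t`, conditionally on the past. -/
lemma le_bitExp_stepGain {p τ : ℝ} (h0 : 0 ≤ p) (h1 : p ≤ 1) (hτ : 0 < τ)
    (σ : Equiv.Perm (Fin n)) (ε : ℝ) (b : Fin n → ℤˣ) (t : Fin n) (ω : Fin m × Fin n → Bool)
    {v : ℝ} (hv : v = 2 * (p * (1 - p)) * oddCount σ ω t) :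
    (p * ∑ ℓ, labelDeg σ ω t ℓ) + (if ((t : ℕ) : ℝ) + 1 ≤ ε * n then 0
      else (3 * τ ^ 2 * v - 3 * v ^ 2 - v) / (4 * τ ^ 3)) ≤
    bitExp p fun η =>
      stepGain (weightMatrix (repMatrix ((columnBits m (σ t)).piecewise η ω))) σ ε b t := by
  simp only [stepGain_piecewise_self, bitExp_add, bitExp_linear]
  rw [sum_columnBits]
  refine add_le_add le_rfl ?_
  split_ifs
  · rw [bitExp_const]
  · have hvar : v = 2 * (p * (1 - p)) * ∑ k ∈ columnBits m (σ t), labelOdd σ ω t k.1 := by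
      rw [hv, sum_columnBits, oddCount]
    have hz : ∀ k : Fin m × Fin n, labelOdd σ ω t k.1 ^ 2 = labelOdd σ ω t k.1 :=
      fun k => labelOdd_sq σ ω t k.1
    have hy : ∀ k : Fin m × Fin n, |labelOdd σ ω t k.1| ≤ |labelBias σ ε b ω t k.1| :=
      fun k => abs_labelOdd_le σ ε b ω t k.1
    exact le_bitExp_abs_linear (ι := Fin m × Fin n) h0 h1 hτ hz hy (columnBits m (σ t)) hvar

/-! ### Second moments -/

/-- The bits that describe which of the vertices before time `t` have a label in `L`. -/
def pastBits (σ : Equiv.Perm (Fin n)) (L : Finset (Fin m)) (t : Fin n) :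
    Finset (Fin m × Fin n) :=
  L ×ˢ (Finset.Iio t).map σ.toEmbedding

lemma card_pastBits (σ : Equiv.Perm (Fin n)) (L : Finset (Fin m)) (t : Fin n) :
    (pastBits σ L t).card = L.card * t := by
  simp [pastBits, Finset.card_product]

/-- A product of `L.card * t` independent factors, each of mean `1 - 2 * p`. -/
lemma bitExp_prod_labelParity (p : ℝ) (σ : Equiv.Perm (Fin n)) (L : Finset (Fin m)) (t : Fin n) :
    bitExp p (fun ω => ∏ ℓ ∈ L, labelParity σ ω t ℓ) = (1 - 2 * p) ^ (L.card * t) := by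
  have h := bitExp_prod p (pastBits σ L t) fun _ b => 1 - 2 * bitVal b
  simp only [bitVal_true, bitVal_false, Finset.prod_const, card_pastBits] at h
  simp only [pastBits, Finset.prod_product, Finset.prod_map] at h
  refine h.trans ?_
  congr 1; ring

lemma bitExp_sum_labelDeg_sq_le {p : ℝ} (h0 : 0 ≤ p) (σ : Equiv.Perm (Fin n))
    (L : Finset (Fin m)) (t : Fin n) :
    bitExp p (fun ω => (∑ ℓ ∈ L, labelDeg σ ω t ℓ) ^ 2) ≤
      p * (L.card * n) + p ^ 2 * (L.card * n) ^ 2 := by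
  have h := bitExp_linear_sq p (pastBits σ L t) fun _ => 1
  simp only [one_mul, one_pow, Finset.sum_const, card_pastBits, nsmul_eq_mul, mul_one] at h
  simp only [pastBits, Finset.sum_product, Finset.sum_map] at h
  refine h.trans_le ?_
  have ht : ((t : ℕ) : ℝ) ≤ n := by exact_mod_cast t.2.le
  push_cast
  gcongr
  nlinarith

lemma abs_labelBias_le (σ : Equiv.Perm (Fin n)) (ε : ℝ) (b : Fin n → ℤˣ)
    (ω : Fin m × Fin n → Bool) (t : Fin n) (ℓ : Fin m) :
    |labelBias σ ε b ω t ℓ| ≤ labelDeg σ ω t ℓ := by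
  refine (Finset.abs_sum_le_sum_abs _ _).trans (Finset.sum_le_sum fun i _ => ?_)
  have : ∀ x : ℤˣ, |signVal x| = 1 := fun x => by
    rcases Int.units_eq_one_or x with rfl | rfl <;> simp [signVal]
  rw [abs_mul, this, one_mul, abs_of_nonneg (bitVal_nonneg _)]

/-- The bias term never exceeds the weight to earlier vertices, so the gain is at most twice that
weight. -/
lemma stepGain_sq_le (σ : Equiv.Perm (Fin n)) (ε : ℝ) (b : Fin n → ℤˣ)
    (ω : Fin m × Fin n → Bool) (t : Fin n) :
    stepGain (weightMatrix (repMatrix ω)) σ ε b t ^ 2 ≤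
      4 * (∑ ℓ, labelDeg σ ω t ℓ * bitVal (ω (ℓ, σ t))) ^ 2 := by
  have hZ : |∑ ℓ, labelBias σ ε b ω t ℓ * bitVal (ω (ℓ, σ t))| ≤
      ∑ ℓ, labelDeg σ ω t ℓ * bitVal (ω (ℓ, σ t)) := by
    refine (Finset.abs_sum_le_sum_abs _ _).trans (Finset.sum_le_sum fun ℓ _ => ?_)
    rw [abs_mul, abs_of_nonneg (bitVal_nonneg _)]
    exact mul_le_mul_of_nonneg_right (abs_labelBias_le σ ε b ω t ℓ) (bitVal_nonneg _)
  have hA := (abs_nonneg _).trans hZ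
  rw [stepGain_eq]
  split_ifs
  · nlinarith
  · nlinarith [abs_nonneg (∑ ℓ, labelBias σ ε b ω t ℓ * bitVal (ω (ℓ, σ t)))]

lemma bitExp_stepGain_sq_le {p : ℝ} (h0 : 0 ≤ p) (h1 : p ≤ 1) (σ : Equiv.Perm (Fin n)) (ε : ℝ)
    (b : Fin n → ℤˣ) (t : Fin n) :
    bitExp p (fun ω : Fin m × Fin n → Bool =>
      stepGain (weightMatrix (repMatrix ω)) σ ε b t ^ 2) ≤
      4 * (p * (m * (p * n + p ^ 2 * n ^ 2)) + p ^ 2 * (p * (m * n) + p ^ 2 * (m * n) ^ 2)) := by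
  refine (bitExp_mono h0 h1 fun ω => stepGain_sq_le σ ε b ω t).trans ?_
  -- Condition on the past: the fresh column gives a quadratic expression in the degrees, whose
  -- moments are then computed.
  rw [bitExp_const_mul, ← bitExp_piecewise p (columnBits m (σ t))]
  have e : ∀ ω η : Fin m × Fin n → Bool, ∀ i < t, ∀ ℓ,
      (columnBits m (σ t)).piecewise η ω (ℓ, σ i) = ω (ℓ, σ i) :=
    fun ω η i hi ℓ => piecewise_columnBits_of_ne ω η (σ.injective.ne hi.ne) ℓ
  have h : ∀ ω : Fin m × Fin n → Bool, (bitExp p fun η => (∑ ℓ, labelDeg σ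
      ((columnBits m (σ t)).piecewise η ω) t ℓ *
        bitVal ((columnBits m (σ t)).piecewise η ω (ℓ, σ t))) ^ 2) ≤
      p * ∑ ℓ, labelDeg σ ω t ℓ ^ 2 + p ^ 2 * (∑ ℓ, labelDeg σ ω t ℓ) ^ 2 := by
    intro ω
    have := bitExp_linear_sq p (columnBits m (σ t)) fun k => labelDeg σ ω t k.1
    simp only [sum_columnBits] at this
    simp only [labelDeg_congr (e ω _), piecewise_columnBits_self, this]
    gcongr
    nlinarith
  gcongr
  refine (bitExp_mono h0 h1 h).trans ?_
  rw [bitExp_add, bitExp_const_mul, bitExp_const_mul, bitExp_sum]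
  have h2 := bitExp_sum_labelDeg_sq_le h0 σ (Finset.univ : Finset (Fin m)) t
  have h3 : ∑ ℓ : Fin m, bitExp p (fun ω => labelDeg σ ω t ℓ ^ 2) ≤
      m * (p * n + p ^ 2 * n ^ 2) := by
    have : ∀ ℓ ∈ (Finset.univ : Finset (Fin m)), bitExp p (fun ω => labelDeg σ ω t ℓ ^ 2) ≤
        p * n + p ^ 2 * n ^ 2 := by
      intro ℓ _
      simpa using bitExp_sum_labelDeg_sq_le h0 σ {ℓ} t
    simpa [mul_add] using Finset.sum_le_card_nsmul _ _ _ this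
  simp only [Finset.card_univ, Fintype.card_fin] at h2
  gcongr

/-- Parities of distinct labels are uncorrelated, so the variance is `m * (1 - r ^ 2) / 4`;
Cauchy–Schwarz then bounds the mean deviation. -/
lemma bitExp_abs_oddCount_sub_le {p : ℝ} (h0 : 0 ≤ p) (h1 : p ≤ 1) (σ : Equiv.Perm (Fin n))
    (t : Fin n) :
    bitExp p (fun ω : Fin m × Fin n → Bool =>
      |oddCount σ ω t - m * (1 - (1 - 2 * p) ^ (t : ℕ)) / 2|) ≤ √m := by
  set r := (1 - 2 * p) ^ (t : ℕ) with hr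
  refine bitExp_abs_le_sqrt h0 h1 ?_
  have e : ∀ ω : Fin m × Fin n → Bool, (oddCount σ ω t - m * (1 - r) / 2) ^ 2 =
      1 / 4 * ∑ ℓ, ∑ ℓ', (labelParity σ ω t ℓ * labelParity σ ω t ℓ' -
        r * labelParity σ ω t ℓ - r * labelParity σ ω t ℓ' + r ^ 2) := by
    intro ω
    have e1 : oddCount σ ω t - m * (1 - r) / 2 = -(1 / 2) * ∑ ℓ, (labelParity σ ω t ℓ - r) := by
      simp only [oddCount, labelOdd, ← Finset.sum_div, Finset.sum_sub_distrib]
      simp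
      ring
    rw [e1, mul_pow, pow_two (∑ ℓ, _), Finset.sum_mul_sum]
    norm_num
    exact Finset.sum_congr rfl fun _ _ => Finset.sum_congr rfl fun _ _ => by ring
  have one : ∀ ℓ : Fin m, bitExp p (fun ω => labelParity σ ω t ℓ) = r := fun ℓ => by
    simpa using bitExp_prod_labelParity p σ {ℓ} t
  have two : ∀ ℓ ℓ' : Fin m,
      bitExp p (fun ω => labelParity σ ω t ℓ * labelParity σ ω t ℓ') =
        r ^ 2 + if ℓ = ℓ' then 1 - r ^ 2 else 0 := fun ℓ ℓ' => by
    split_ifs with h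
    · subst h
      simp only [← pow_two, labelParity_sq, bitExp_const]; ring
    · have := bitExp_prod_labelParity p σ {ℓ, ℓ'} t
      simp only [Finset.prod_pair h, Finset.card_pair h] at this
      rw [this, hr]; ring
  simp only [e, bitExp_const_mul, bitExp_sum, bitExp_add, bitExp_sub, one, two, bitExp_const]
  have s : ∀ ℓ ℓ' : Fin m, (r ^ 2 + if ℓ = ℓ' then 1 - r ^ 2 else 0) - r * r - r * r + r ^ 2 =
      if ℓ = ℓ' then 1 - r ^ 2 else 0 := fun ℓ ℓ' => by ring
  simp only [s, Finset.sum_ite_eq, Finset.mem_univ, if_true, Finset.sum_const, Finset.card_univ,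
    Fintype.card_fin, nsmul_eq_mul]
  have hm : (0 : ℝ) ≤ m := Nat.cast_nonneg m
  nlinarith [mul_nonneg hm (sq_nonneg r)]

end Labels

/-! ### Expected weights -/

lemma sum_ne_eq_two_mul_sum (n : ℕ) (a : ℝ) :
    ∑ i : Fin n, ∑ j : Fin n, (if i ≠ j then a else 0) = 2 * ∑ t : Fin n, (t : ℝ) * a := by
  rw [sum_sum_eq_two_mul_sum_Iio (fun i j : Fin n => if i ≠ j then a else 0)
    (fun s t => by simp only [ne_comm]) (fun t => by simp)]
  congr 1
  refine Finset.sum_congr rfl fun t _ => ?_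
  rw [Finset.sum_congr rfl fun s hs => if_pos (Finset.mem_Iio.1 hs).ne]
  simp

lemma bitExp_totalWeight (m n : ℕ) (p : ℝ) :
    bitExp p (fun ω : Fin m × Fin n → Bool => ∑ i, ∑ j,
      if i ≠ j then weightMatrix (repMatrix ω) i j else 0) =
      2 * ∑ t : Fin n, (t : ℝ) * (m * p ^ 2) := by
  rw [← sum_ne_eq_two_mul_sum]
  simp only [bitExp_sum]
  refine Finset.sum_congr rfl fun i _ => Finset.sum_congr rfl fun j _ => ?_
  split_ifs with h
  · simp only [weightMatrix_repMatrix, bitExp_sum]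
    rw [Finset.sum_congr rfl fun ℓ _ =>
      bitExp_bitVal_mul p (k := (ℓ, i)) (l := (ℓ, j)) (by simp [h])]
    simp
  · exact bitExp_const p 0

lemma two_mul_sum_fin_le (n : ℕ) : 2 * ∑ t : Fin n, (t : ℝ) ≤ (n : ℝ) ^ 2 := by
  rw [Fin.sum_univ_eq_sum_range fun i => (i : ℝ)]
  have h := Finset.sum_range_id_mul_two n
  have h2 : (∑ i ∈ Finset.range n, i) * 2 ≤ n ^ 2 := by
    rw [h, pow_two]; exact Nat.mul_le_mul_left _ (Nat.sub_le _ _)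
  have h3 : (((∑ i ∈ Finset.range n, i) * 2 : ℕ) : ℝ) ≤ ((n ^ 2 : ℕ) : ℝ) := by exact_mod_cast h2
  push_cast at h3
  linarith

lemma bitExp_expect {ι κ : Type*} [Fintype ι] [DecidableEq ι] [Fintype κ] (p : ℝ)
    (f : κ → (ι → Bool) → ℝ) :
    bitExp p (fun ω => 𝔼 b, f b ω) = 𝔼 b, bitExp p (f b) := by
  simp only [bitExp, Finset.mul_expect, Finset.expect_sum_comm]

lemma bitExp_abs_sum_labelDeg_sub_le {m n : ℕ} {p : ℝ} (h0 : 0 ≤ p) (h1 : p ≤ 1)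
    (σ : Equiv.Perm (Fin n)) (t : Fin n) :
    bitExp p (fun ω : Fin m × Fin n → Bool => |∑ ℓ, labelDeg σ ω t ℓ - p * (m * t)|) ≤
      √(p * (m * n)) := by
  refine bitExp_abs_le_sqrt h0 h1 ?_
  have h := bitExp_linear_sub_sq p (pastBits σ (Finset.univ : Finset (Fin m)) t) fun _ => 1
  simp only [one_mul, one_pow, Finset.sum_const, card_pastBits, nsmul_eq_mul, mul_one,
    Finset.card_univ, Fintype.card_fin] at h
  simp only [pastBits, Finset.sum_product, Finset.sum_map, Nat.cast_mul] at h
  refine h.trans_le ?_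
  have ht : ((t : ℕ) : ℝ) ≤ n := by exact_mod_cast t.2.le
  gcongr
  nlinarith

/-! ### The bias exploited by the algorithm -/

/-- The lower bound for the expected bias when the variance of the contracted form is `v`. -/
noncomputable def biasBound (c v : ℝ) : ℝ :=
  (3 * √(3 * c) ^ 2 * v - 3 * v ^ 2 - v) / (4 * √(3 * c) ^ 3)

/-- A Lipschitz constant of `biasBound c` on the interval `[0, 2 * c]`. -/
noncomputable def biasLip (c : ℝ) : ℝ := (21 * c + 1) / (4 * √(3 * c) ^ 3)

/-- Allows the random variance `v` to be replaced by its typical value `w`, at a cost linear in the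
deviation of the odd count. -/
lemma biasBound_sub_le {c v w : ℝ} (hc : 0 < c) (hv : 0 ≤ v) (hv' : v ≤ 2 * c) (hw : 0 ≤ w)
    (hw' : w ≤ 2 * c) : biasBound c w - biasLip c * |v - w| ≤ biasBound c v := by
  have hτ : √(3 * c) ^ 2 = 3 * c := Real.sq_sqrt (by positivity)
  have hp : 0 < 4 * √(3 * c) ^ 3 := by positivity
  rw [biasBound, biasBound, biasLip, div_mul_eq_mul_div, ← sub_div, hτ,
    div_le_div_iff_of_pos_right hp]
  have e : (3 * (3 * c) * v - 3 * v ^ 2 - v) - (3 * (3 * c) * w - 3 * w ^ 2 - w) =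
      (9 * c - 1 - 3 * (v + w)) * (v - w) := by ring
  have h1 : |9 * c - 1 - 3 * (v + w)| ≤ 21 * c + 1 := by
    rw [abs_le]; constructor <;> linarith
  have h2 := neg_abs_le ((9 * c - 1 - 3 * (v + w)) * (v - w))
  rw [abs_mul] at h2
  have h3 := mul_le_mul_of_nonneg_right h1 (abs_nonneg (v - w))
  linarith

/-- On `[0, c]` one has `v ^ 2 ≤ c * v`, which makes the bound linear in `v` and easy to sum over
the steps. -/
lemma le_biasBound {c v : ℝ} (hc : 0 < c) (hv : 0 ≤ v) (hv' : v ≤ c) :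
    (6 * c - 1) / (4 * √(3 * c) ^ 3) * v ≤ biasBound c v := by
  have hτ : √(3 * c) ^ 2 = 3 * c := Real.sq_sqrt (by positivity)
  rw [biasBound, div_mul_eq_mul_div, hτ, div_le_div_iff_of_pos_right (by positivity)]
  nlinarith

open Classical in
lemma sum_early_le {n : ℕ} {ε : ℝ} (hε : 0 ≤ ε) :
    ∑ t : Fin n, (if ((t : ℕ) : ℝ) + 1 ≤ ε * n then (1 : ℝ) else 0) ≤ ε * n := by
  have hεn : 0 ≤ ε * n := by positivity
  rw [Fin.sum_univ_eq_sum_range fun i => if (i : ℝ) + 1 ≤ ε * n then (1 : ℝ) else 0,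
    ← Finset.sum_filter, Finset.sum_const, nsmul_eq_mul, mul_one]
  refine le_trans ?_ (Nat.floor_le hεn)
  have : (Finset.range n).filter (fun i : ℕ => (i : ℝ) + 1 ≤ ε * n) ⊆
      Finset.range ⌊ε * n⌋₊ := by
    intro i hi
    rw [Finset.mem_range, ← Nat.succ_le_iff, Nat.le_floor_iff hεn]
    push_cast
    exact (Finset.mem_filter.1 hi).2
  simpa using Nat.cast_le (α := ℝ).2 (Finset.card_le_card this)

lemma mul_sum_pow_le {r : ℝ} (h0 : 0 ≤ r) (n : ℕ) :
    (1 - r) * ∑ t : Fin n, r ^ (t : ℕ) ≤ 1 := by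
  rw [Fin.sum_univ_eq_sum_range fun i => r ^ i, mul_neg_geom_sum]
  linarith [pow_nonneg h0 n]

open Classical in
lemma le_sum_biasBound {c ε : ℝ} (hc : 10 ≤ c) (hε0 : 0 ≤ ε) {n : ℕ} (hn : 100 * c ≤ n) :
    (6 * c - 1) / (4 * √(3 * c) ^ 3) * (c * (1 - c / n)) * (n * (1 - ε - 1 / (2 * c))) ≤
      ∑ t : Fin n, if ((t : ℕ) : ℝ) + 1 ≤ ε * n then 0
        else biasBound c (c * (1 - c / n) * (1 - (1 - 2 * (c / n)) ^ (t : ℕ))) := by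
  have hn0 : (0 : ℝ) < n := by linarith
  set p := c / n with hp
  have hp0 : 0 < p := by positivity
  have hp1 : p ≤ 1 / 100 := by rw [hp, div_le_iff₀ hn0]; linarith
  set r := 1 - 2 * p with hr
  have hr0 : 0 ≤ r := by linarith
  have hr1 : r ≤ 1 := by linarith
  set K := (6 * c - 1) / (4 * √(3 * c) ^ 3) with hK
  have hK0 : 0 ≤ K := div_nonneg (by linarith) (by positivity)
  have hA : 0 ≤ c * (1 - p) := mul_nonneg (by linarith) (by linarith)
  -- Subtracting the indicator of the random phase makes the left side nonpositive there, so one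
  -- formula covers both phases.
  have hterm : ∀ t : Fin n, K * (c * (1 - p)) *
      (1 - r ^ (t : ℕ) - if ((t : ℕ) : ℝ) + 1 ≤ ε * n then 1 else 0) ≤
      if ((t : ℕ) : ℝ) + 1 ≤ ε * n then 0 else biasBound c (c * (1 - p) * (1 - r ^ (t : ℕ))) := by
    intro t
    have s0 : 0 ≤ r ^ (t : ℕ) := pow_nonneg hr0 _
    have s1 : r ^ (t : ℕ) ≤ 1 := pow_le_one₀ hr0 hr1
    split_ifs
    · exact mul_nonpos_of_nonneg_of_nonpos (mul_nonneg hK0 hA) (by linarith)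
    · rw [sub_zero, mul_assoc]
      refine le_biasBound (by linarith) (mul_nonneg hA (by linarith)) ?_
      have : (1 - p) * (1 - r ^ (t : ℕ)) ≤ 1 := mul_le_one₀ (by linarith) (by linarith) (by linarith)
      nlinarith
  refine le_trans ?_ (Finset.sum_le_sum fun t _ => hterm t)
  rw [← Finset.mul_sum]
  refine mul_le_mul_of_nonneg_left ?_ (mul_nonneg hK0 hA)
  simp only [Finset.sum_sub_distrib, Finset.sum_const, Finset.card_univ, Fintype.card_fin,
    nsmul_eq_mul, mul_one]
  have h1 := sum_early_le (n := n) hε0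
  -- The geometric series sums to at most `1 / (2 * p) = n / (2 * c)`: the steps at which parities
  -- are not yet balanced cost only this much.
  have h2 : ∑ t : Fin n, r ^ (t : ℕ) ≤ n * (1 / (2 * c)) := by
    have := mul_sum_pow_le hr0 n
    have e : (n : ℝ) * (1 / (2 * c)) = 1 / (2 * p) := by
      rw [hp]; field_simp
    rw [e, le_div_iff₀ (by linarith)]
    linarith
  linarith

lemma le_majority_gain {c ε : ℝ} (hc : 10 ≤ c) (hε : ε < 1 / 10) {n : ℕ} (hn : 100 * c ≤ n) :
    √(16 / (27 * Real.pi * c ^ 3)) * (1 / 4 * (c ^ 2 * n)) + n / 100 ≤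
      1 / 2 * ((6 * c - 1) / (4 * √(3 * c) ^ 3) * (c * (1 - c / n)) *
        (n * (1 - ε - 1 / (2 * c)))) := by
  have hn0 : (0 : ℝ) < n := by linarith
  set w := √c with hw
  have hw2 : w ^ 2 = c := Real.sq_sqrt (by linarith)
  have hw3 : 3.16 ≤ w := Real.le_sqrt_of_sq_le (by norm_num; linarith)
  have hw0 : 0 < w := by linarith
  have hβ : √(16 / (27 * Real.pi * c ^ 3)) * (1 / 4 * c ^ 2) ≤ 0.1087 * w := by
    -- The number `0.4348` is just above `√(16 / (27 * π))`.
    have : √(16 / (27 * Real.pi * c ^ 3)) ≤ 0.4348 / w ^ 3 := by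
      refine Real.sqrt_le_iff.2 ⟨by positivity, ?_⟩
      rw [div_pow, ← pow_mul, mul_comm 3 2, pow_mul, hw2,
        div_le_div_iff₀ (by positivity) (by positivity)]
      have := Real.pi_gt_d2
      have hc3 : 0 < c ^ 3 := by positivity
      nlinarith
    calc _ ≤ 0.4348 / w ^ 3 * (1 / 4 * c ^ 2) := by gcongr
      _ = 0.1087 * w := by
        rw [← hw2]; field_simp; norm_num
  have h3 : √3 ≤ 1.7321 := Real.sqrt_le_iff.2 ⟨by norm_num, by norm_num⟩
  have hτ : √(3 * c) ^ 3 = 3 * c * (√3 * w) := by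
    rw [pow_succ, Real.sq_sqrt (by linarith), Real.sqrt_mul (by norm_num)]
  have hp : 0.99 ≤ 1 - c / n := by
    have : c / n ≤ 1 / 100 := by rw [div_le_iff₀ hn0]; linarith
    linarith
  have hε' : 0.85 ≤ 1 - ε - 1 / (2 * c) := by
    have : 1 / (2 * c) ≤ 1 / 20 := by
      apply one_div_le_one_div_of_le <;> linarith
    linarith
  -- From `c ≥ 10` one gets `6 * c - 1 ≥ 5.9 * c`, and `5.9 / (12 * √3)` exceeds `0.28385`.
  have hK : 0.28385 * w ≤ (6 * c - 1) / (4 * √(3 * c) ^ 3) * c := by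
    rw [hτ, div_mul_eq_mul_div, le_div_iff₀ (by positivity)]
    have : √3 * w ^ 2 ≤ 1.7321 * c := by rw [hw2]; gcongr
    have e : 0.28385 * w * (4 * (3 * c * (√3 * w))) = 3.4062 * c * (√3 * w ^ 2) := by ring
    rw [e]
    have h5 : 3.4062 * c * (√3 * w ^ 2) ≤ 3.4062 * c * (1.7321 * c) := by gcongr
    nlinarith
  have hmain : 0.28385 * w * 0.99 * 0.85 ≤ (6 * c - 1) / (4 * √(3 * c) ^ 3) * c * (1 - c / n) *
      (1 - ε - 1 / (2 * c)) := by
    have hK0 := (by positivity : 0 ≤ 0.28385 * w).trans hK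
    refine mul_le_mul (mul_le_mul hK hp (by norm_num) hK0) hε' (by norm_num) ?_
    exact mul_nonneg hK0 (by linarith)
  have key : √(16 / (27 * Real.pi * c ^ 3)) * (1 / 4 * c ^ 2) + 1 / 100 ≤
      1 / 2 * ((6 * c - 1) / (4 * √(3 * c) ^ 3) * c * (1 - c / n) * (1 - ε - 1 / (2 * c))) := by
    nlinarith
  calc _ = (√(16 / (27 * Real.pi * c ^ 3)) * (1 / 4 * c ^ 2) + 1 / 100) * n := by ring
    _ ≤ _ := mul_le_mul_of_nonneg_right key hn0.le
    _ = _ := by ring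

/-! ### The deviation of the Majority Cut from its typical weight -/

section Deviation

variable {n : ℕ}

/-- The sum over all steps of the differences between the gain and its conditional expectation. -/
noncomputable def gainNoise (p : ℝ) (σ : Equiv.Perm (Fin n)) (ε : ℝ) (b : Fin n → ℤˣ)
    (ω : Fin n × Fin n → Bool) : ℝ :=
  ∑ t, (stepGain (weightMatrix (repMatrix ω)) σ ε b t - bitExp p fun η =>
    stepGain (weightMatrix (repMatrix ((columnBits n (σ t)).piecewise η ω))) σ ε b t)

/-- A bound for the deviation of the weight of the Majority Cut below its typical value. -/
noncomputable def deviation (c : ℝ) (σ : Equiv.Perm (Fin n)) (ε : ℝ)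
    (ω : Fin n × Fin n → Bool) : ℝ :=
  1 / 2 * ((𝔼 b : Fin n → ℤˣ, |gainNoise (c / n) σ ε b ω|) +
    ∑ t : Fin n, (c / n * |∑ ℓ, labelDeg σ ω t ℓ - c / n * (n * t)| +
      biasLip c * (2 * (c / n)) *
        |oddCount σ ω t - n * (1 - (1 - 2 * (c / n)) ^ (t : ℕ)) / 2|))

/-- The mean deviation is at most this constant times `√n`. -/
noncomputable def deviationConst (c : ℝ) : ℝ :=
  1 / 2 * (√(4 * (c * (c + c ^ 2) + c ^ 2 * (c + c ^ 2))) + c * √c + biasLip c * (2 * c))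

lemma biasLip_nonneg {c : ℝ} (hc : 0 < c) : 0 ≤ biasLip c := by
  unfold biasLip; positivity

lemma deviation_nonneg {c : ℝ} (hc : 0 < c) (σ : Equiv.Perm (Fin n)) (ε : ℝ)
    (ω : Fin n × Fin n → Bool) : 0 ≤ deviation c σ ε ω := by
  have h := biasLip_nonneg hc
  have h1 : 0 ≤ 𝔼 b : Fin n → ℤˣ, |gainNoise (c / n) σ ε b ω| :=
    Finset.expect_nonneg fun _ _ => abs_nonneg _
  have h2 : 0 ≤ ∑ t : Fin n, (c / n * |∑ ℓ, labelDeg σ ω t ℓ - c / n * (n * t)| +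
      biasLip c * (2 * (c / n)) *
        |oddCount σ ω t - n * (1 - (1 - 2 * (c / n)) ^ (t : ℕ)) / 2|) :=
    Finset.sum_nonneg fun t _ => by positivity
  unfold deviation
  positivity

/-- Columns are disjoint blocks of bits, so the noise is a sum of `n` orthogonal terms with second
moments bounded in terms of `c` alone. -/
lemma bitExp_abs_gainNoise_le {c : ℝ} (hc : 0 < c) (hn : c ≤ n) (σ : Equiv.Perm (Fin n)) (ε : ℝ)
    (b : Fin n → ℤˣ) :
    bitExp (c / n) (fun ω => |gainNoise (c / n) σ ε b ω|) ≤
      √(4 * (c * (c + c ^ 2) + c ^ 2 * (c + c ^ 2))) * √n := by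
  have hn0 : (0 : ℝ) < n := by linarith
  have hn1 : (1 : ℝ) ≤ n := by exact_mod_cast (by exact_mod_cast hn0 : 0 < n)
  have h0 : 0 ≤ c / n := by positivity
  have h1 : c / n ≤ 1 := (div_le_one hn0).2 hn
  rw [← Real.sqrt_mul (by positivity)]
  refine bitExp_abs_le_sqrt h0 h1 ((bitExp_sum_sub_sq_le h0 h1 (fun t => columnBits n (σ t))
    (fun t u htu => ?_) (fun t ω => stepGain (weightMatrix (repMatrix ω)) σ ε b t)
    fun t u htu ω η => stepGain_piecewise_of_lt σ ε b htu ω η).trans ?_)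
  · rw [Finset.disjoint_left]
    intro k hk hk'
    rw [mem_columnBits] at hk hk'
    exact htu.ne (σ.injective (hk.symm.trans hk'))
  · have hpn : c / n * n = c := by field_simp
    have hle : ∀ t ∈ (Finset.univ : Finset (Fin n)), bitExp (c / n)
        (fun ω : Fin n × Fin n → Bool => stepGain (weightMatrix (repMatrix ω)) σ ε b t ^ 2) ≤
          4 * (c * (c + c ^ 2) + c ^ 2 * (c + c ^ 2)) := by
      intro t _
      refine (bitExp_stepGain_sq_le h0 h1 σ ε b t).trans ?_
      have e : c / n * (n * (c / n * n + (c / n) ^ 2 * (n : ℝ) ^ 2)) +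
          (c / n) ^ 2 * (c / n * (n * n) + (c / n) ^ 2 * ((n : ℝ) * n) ^ 2) =
          c * (c + c ^ 2) + c ^ 2 * (c / n + c ^ 2) := by
        field_simp
      rw [e]
      have : c / n ≤ c := div_le_self hc.le hn1
      gcongr
    refine (Finset.sum_le_card_nsmul _ _ _ hle).trans_eq ?_
    simp [mul_comm]

lemma bitExp_deviation_le {c : ℝ} (hc : 0 < c) (hn : c ≤ n) (σ : Equiv.Perm (Fin n)) (ε : ℝ) :
    bitExp (c / n) (deviation c σ ε) ≤ deviationConst c * √n := by
  have hn0 : (0 : ℝ) < n := by linarith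
  have h0 : 0 ≤ c / n := by positivity
  have h1 : c / n ≤ 1 := (div_le_one hn0).2 hn
  have hL := biasLip_nonneg hc
  unfold deviation deviationConst
  rw [bitExp_const_mul, mul_assoc, bitExp_add, bitExp_expect, bitExp_sum]
  simp only [bitExp_add, bitExp_const_mul]
  have hA : 𝔼 b : Fin n → ℤˣ, bitExp (c / n) (fun ω => |gainNoise (c / n) σ ε b ω|) ≤
      √(4 * (c * (c + c ^ 2) + c ^ 2 * (c + c ^ 2))) * √n :=
    Finset.expect_le Finset.univ_nonempty fun b _ => bitExp_abs_gainNoise_le hc hn σ ε b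
  have hB : ∀ t ∈ (Finset.univ : Finset (Fin n)),
      c / n * bitExp (c / n) (fun ω : Fin n × Fin n → Bool =>
        |∑ ℓ, labelDeg σ ω t ℓ - c / n * (n * t)|) +
      biasLip c * (2 * (c / n)) * bitExp (c / n) (fun ω : Fin n × Fin n → Bool =>
        |oddCount σ ω t - n * (1 - (1 - 2 * (c / n)) ^ (t : ℕ)) / 2|) ≤
      c / n * (√c * √n) + biasLip c * (2 * (c / n)) * √n := by
    intro t _
    have e1 := bitExp_abs_sum_labelDeg_sub_le (m := n) h0 h1 σ t
    have e2 := bitExp_abs_oddCount_sub_le (m := n) h0 h1 σ t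
    rw [show c / n * ((n : ℝ) * n) = c * n by field_simp, Real.sqrt_mul hc.le] at e1
    gcongr
  have hB' := Finset.sum_le_card_nsmul _ _ _ hB
  have e : (Finset.univ : Finset (Fin n)).card •
      (c / n * (√c * √n) + biasLip c * (2 * (c / n)) * √n) =
        (c * √c + biasLip c * (2 * c)) * √n := by
    rw [Finset.card_univ, Fintype.card_fin, nsmul_eq_mul]
    field_simp
  rw [e] at hB'
  linarith

open Classical in
-- The conditional mean gain depends on the past only through the total degree and the odd count;
-- each is replaced by its typical value and the error is recorded.
lemma le_stepGain_average {c : ℝ} (hc : 0 < c) (hn : c ≤ n) (σ : Equiv.Perm (Fin n)) (ε : ℝ)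
    (b : Fin n → ℤˣ) (ω : Fin n × Fin n → Bool) (t : Fin n) :
    (t : ℝ) * (n * (c / n) ^ 2) + (if ((t : ℕ) : ℝ) + 1 ≤ ε * n then 0
        else biasBound c (c * (1 - c / n) * (1 - (1 - 2 * (c / n)) ^ (t : ℕ)))) -
      (c / n * |∑ ℓ, labelDeg σ ω t ℓ - c / n * (n * t)| + biasLip c * (2 * (c / n)) *
        |oddCount σ ω t - n * (1 - (1 - 2 * (c / n)) ^ (t : ℕ)) / 2|) ≤
    bitExp (c / n) fun η =>
      stepGain (weightMatrix (repMatrix ((columnBits n (σ t)).piecewise η ω))) σ ε b t := by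
  have hn0 : (0 : ℝ) < n := by linarith
  have hL := biasLip_nonneg hc
  have hpn : c / n * n = c := by field_simp
  set p := c / n with hp
  have h0 : 0 ≤ p := by positivity
  have h1 : p ≤ 1 := (div_le_one hn0).2 hn
  refine le_trans ?_ (le_bitExp_stepGain h0 h1 (τ := √(3 * c)) (by positivity) σ ε b t ω rfl)
  change _ ≤ _ + if _ then 0 else biasBound c (2 * (p * (1 - p)) * oddCount σ ω t)
  set N := oddCount σ ω t with hN
  set s := (1 - 2 * p) ^ (t : ℕ) with hs
  have hs1 : |s| ≤ 1 := by
    rw [hs, abs_pow]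
    exact pow_le_one₀ (abs_nonneg _) (abs_le.2 ⟨by linarith, by linarith⟩)
  have hs2 := abs_le.1 hs1
  have hN0 : 0 ≤ N := oddCount_nonneg σ ω t
  have hN1 : N ≤ n := oddCount_le σ ω t
  have hlin : (t : ℝ) * (n * p ^ 2) - p * |∑ ℓ, labelDeg σ ω t ℓ - p * (n * t)| ≤
      p * ∑ ℓ, labelDeg σ ω t ℓ := by
    have := mul_le_mul_of_nonneg_left (neg_abs_le (∑ ℓ, labelDeg σ ω t ℓ - p * (n * t))) h0
    linarith [this, show p * (∑ ℓ, labelDeg σ ω t ℓ - p * (n * t)) =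
      p * ∑ ℓ, labelDeg σ ω t ℓ - (t : ℝ) * (n * p ^ 2) by ring]
  have hdev : 0 ≤ biasLip c * (2 * p) * |N - n * (1 - s) / 2| := by positivity
  split_ifs with ht
  · linarith
  · have hq0 : 0 ≤ 2 * (p * (1 - p)) := by nlinarith
    have hq : 2 * (p * (1 - p)) ≤ 2 * p := by nlinarith
    have key := biasBound_sub_le (v := 2 * (p * (1 - p)) * N) (w := c * (1 - p) * (1 - s)) hc
      (by positivity)
      (by calc _ ≤ 2 * p * n := by gcongr
            _ = 2 * c := by linarith)
      (mul_nonneg (mul_nonneg hc.le (by linarith)) (by linarith))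
      (by
        have : (1 - p) * (1 - s) ≤ 1 * 2 :=
          mul_le_mul (by linarith) (by linarith) (by linarith) (by norm_num)
        nlinarith)
    have e : 2 * (p * (1 - p)) * N - c * (1 - p) * (1 - s) =
        2 * (p * (1 - p)) * (N - n * (1 - s) / 2) := by
      linear_combination (1 - p) * (1 - s) * hpn
    rw [e, abs_mul, abs_of_nonneg hq0] at key
    have : biasLip c * (2 * (p * (1 - p)) * |N - n * (1 - s) / 2|) ≤
        biasLip c * (2 * p) * |N - n * (1 - s) / 2| := by
      rw [← mul_assoc]; gcongr
    linarith

lemma le_majorityExpectedWeight {c ε : ℝ} (hc : 10 ≤ c) (hε0 : 0 < ε) (hε : ε < 1 / 10)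
    (hn : 100 * c ≤ n) (σ : Equiv.Perm (Fin n)) (ω : Fin n × Fin n → Bool) :
    (1 + √(16 / (27 * Real.pi * c ^ 3))) *
        (1 / 4 * (2 * ∑ t : Fin n, (t : ℝ) * (n * (c / n) ^ 2))) + n / 100 - deviation c σ ε ω ≤
      majorityExpectedWeight (weightMatrix (repMatrix ω)) σ ε := by
  classical
  have hn0 : (0 : ℝ) < n := by linarith
  rw [majorityExpectedWeight_eq (weightMatrix_repMatrix_comm ω)]
  set B := ∑ t : Fin n, if ((t : ℕ) : ℝ) + 1 ≤ ε * n then 0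
    else biasBound c (c * (1 - c / n) * (1 - (1 - 2 * (c / n)) ^ (t : ℕ))) with hB
  set T := ∑ t : Fin n, (t : ℝ) * (n * (c / n) ^ 2) with hT
  set D := ∑ t : Fin n, (c / n * |∑ ℓ, labelDeg σ ω t ℓ - c / n * (n * t)| +
      biasLip c * (2 * (c / n)) *
        |oddCount σ ω t - n * (1 - (1 - 2 * (c / n)) ^ (t : ℕ)) / 2|) with hD
  have step : ∀ b : Fin n → ℤˣ, T + B - D - |gainNoise (c / n) σ ε b ω| ≤
      ∑ t, stepGain (weightMatrix (repMatrix ω)) σ ε b t := by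
    intro b
    have h1 := Finset.sum_le_sum fun t (_ : t ∈ (Finset.univ : Finset (Fin n))) =>
      le_stepGain_average (by linarith : 0 < c) (by linarith : c ≤ n) σ ε b ω t
    rw [Finset.sum_sub_distrib, Finset.sum_add_distrib, ← hB, ← hT, ← hD] at h1
    have h2 := neg_abs_le (gainNoise (c / n) σ ε b ω)
    have h3 : gainNoise (c / n) σ ε b ω = _ := Finset.sum_sub_distrib _ _
    linarith
  have avg : T + B - D - 𝔼 b : Fin n → ℤˣ, |gainNoise (c / n) σ ε b ω| ≤
      𝔼 b : Fin n → ℤˣ, ∑ t, stepGain (weightMatrix (repMatrix ω)) σ ε b t := by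
    have h := Finset.expect_le_expect fun b (_ : b ∈ (Finset.univ : Finset (Fin n → ℤˣ))) => step b
    rwa [Finset.expect_sub_distrib, Finset.expect_const Finset.univ_nonempty] at h
  have gain := (le_majority_gain hc hε hn).trans
    (mul_le_mul_of_nonneg_left (le_sum_biasBound hc hε0.le hn) (by norm_num : (0 : ℝ) ≤ 1 / 2))
  rw [← hB] at gain
  -- The expected total weight `2 * T` is bounded by `c ^ 2 * n`, the normalization used in
  -- `le_majority_gain`.
  have hTle : 2 * T ≤ c ^ 2 * n := by
    have := mul_le_mul_of_nonneg_right (two_mul_sum_fin_le n)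
      (by positivity : 0 ≤ n * (c / n) ^ 2)
    calc 2 * T = (2 * ∑ t : Fin n, (t : ℝ)) * (n * (c / n) ^ 2) := by
          rw [hT, ← Finset.sum_mul]; ring
      _ ≤ (n : ℝ) ^ 2 * (n * (c / n) ^ 2) := this
      _ = c ^ 2 * n := by field_simp
  have hβ : √(16 / (27 * Real.pi * c ^ 3)) * (1 / 4 * (2 * T)) ≤
      √(16 / (27 * Real.pi * c ^ 3)) * (1 / 4 * (c ^ 2 * n)) := by gcongr
  have hdev : deviation c σ ε ω =
      1 / 2 * ((𝔼 b : Fin n → ℤˣ, |gainNoise (c / n) σ ε b ω|) + D) := rfl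
  rw [hdev]
  linarith

end Deviation

theorem mainTheorem3 :
    (∀ (m n : ℕ) (p : unitInterval),
      ∫ ω, randomCutExpectedWeight (weightMatrix (repMatrix ω)) ∂(labelLaw m n p) =
        1 / 4 * ∫ ω, (∑ i, ∑ j, if i ≠ j then weightMatrix (repMatrix ω) i j else 0)
          ∂(labelLaw m n p)) ∧
    ∃ c₀ : ℝ, 0 < c₀ ∧ ∀ c : ℝ, c₀ ≤ c → ∀ δ : ℝ, 0 < δ →
      ∃ β : ℝ, √(16 / (27 * Real.pi * c ^ 3)) - δ ≤ β ∧
        ∃ ε₀ : ℝ, 0 < ε₀ ∧ ε₀ < 1 ∧ ∀ ε : ℝ, 0 < ε → ε < ε₀ →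
          ∀ σ : (n : ℕ) → Equiv.Perm (Fin n),
            Tendsto
              (fun n : ℕ => (labelLaw n n (sparseProb c n)).real
                {ω | (1 + β) * (1 / 4 * ∫ ω', (∑ i, ∑ j,
                        if i ≠ j then weightMatrix (repMatrix ω') i j else 0)
                        ∂(labelLaw n n (sparseProb c n))) ≤
                    majorityExpectedWeight (weightMatrix (repMatrix ω)) (σ n) ε})
              atTop (𝓝 1) := by
  -- The witnesses `10` and `1 / 10` are the thresholds of `le_majority_gain`, whose margin permits
  -- `β` to be the square root itself.
  refine ⟨fun m n p => ?_, 10, by norm_num, fun c hc δ hδ => ⟨√(16 / (27 * Real.pi * c ^ 3)),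
    by linarith, 1 / 10, by norm_num, by norm_num, fun ε hε0 hε σ => ?_⟩⟩
  · simp only [randomCutExpectedWeight_eq, integral_const_mul]
  · have hlim : Tendsto (fun n : ℕ => 1 - 100 * deviationConst c * (√(n : ℝ))⁻¹) atTop (𝓝 1) := by
      have h := (tendsto_inv_atTop_zero.comp
        (Real.tendsto_sqrt_atTop.comp tendsto_natCast_atTop_atTop)).const_mul
          (100 * deviationConst c)
      simpa using h.const_sub 1
    refine tendsto_of_tendsto_of_tendsto_of_le_of_le' hlim tendsto_const_nhds ?_ ?_
    -- For `n ≥ 100 * c` the projection to the unit interval leaves `c / n` unchanged, and `1 - c /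
    -- n ≥ 0.99`.
    · filter_upwards [tendsto_natCast_atTop_atTop.eventually_ge_atTop (100 * c)] with n hn
      have hn0 : (0 : ℝ) < n := by linarith
      have hp : ((sparseProb c n : unitInterval) : ℝ) = c / n := by
        rw [sparseProb, Set.projIcc_of_mem _ ⟨by positivity, (div_le_one hn0).2 (by linarith)⟩]
      rw [integral_labelLaw, bitExp_totalWeight, hp]
      have h := one_sub_le_labelLaw_real n n (sparseProb c n)
        (fun ω => majorityExpectedWeight (weightMatrix (repMatrix ω)) (σ n) ε)
        (deviation c (σ n) ε) (g := n / 100) (by positivity)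
        (deviation_nonneg (by linarith) (σ n) ε)
        (le_majorityExpectedWeight hc hε0 hε hn (σ n))
      refine le_trans ?_ h
      rw [hp]
      have hd := bitExp_deviation_le (by linarith : 0 < c) (by linarith : c ≤ n) (σ n) ε
      have hs : 0 < √(n : ℝ) := Real.sqrt_pos.2 hn0
      have : bitExp (c / n) (deviation c (σ n) ε) / (n / 100) ≤
          100 * deviationConst c * (√(n : ℝ))⁻¹ := by
        rw [div_le_iff₀ (by positivity)]
        refine hd.trans_eq ?_
        have e : (n : ℝ) = √n * √n := (Real.mul_self_sqrt hn0.le).symm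
        rw [show 100 * deviationConst c * (√(n : ℝ))⁻¹ * ((n : ℝ) / 100) =
          deviationConst c * ((√(n : ℝ))⁻¹ * n) by ring]
        congr 1
        rw [eq_inv_mul_iff_mul_eq₀ hs.ne', ← e]
      linarith
    · filter_upwards with n
      have : IsProbabilityMeasure (labelLaw n n (sparseProb c n)) := by
        unfold labelLaw; infer_instance
      exact measureReal_le_one
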